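/- Let $(\varphi_e)_{e\in\mathbb N}$ and $(\Phi_e)_{e\in\mathbb N}$ be standard effective enumerations of the partial computable functions on $\mathbb N$ and of the Turing functionals on $\mathbb N^{\mathbb N}$. For $k\in\mathbb N$ let $\mathsf{DNR}_k$ be the set of all $f:\mathbb N\to\{0,\dots,k-1\}$ with $f(e)\ne\varphi_e(e)$ whenever $\varphi_e(e)$ converges. A learner is a total computable function $\Psi:\mathbb N^{<\mathbb N}\to\mathbb N$; it identifies a partial function $\Gamma:\subseteq\mathbb N^{\mathbb N}\to\mathbb N^{\mathbb N}$ on $g$ if $e=\lim_n\Psi(g\upharpoonright n)$ exists and $\Phi_e(g)=\Gamma(g)$. It is confident if $\lim_n\Psi(f\upharpoonright n)$ exists for every $f\in\mathbb N^{\mathbb N}$, and eventually-Popperian if, for every $f\in\mathbb N^{\mathbb N}$ such that $e=\lim_n\Psi(f\upharpoonright n)$ exists, $\Phi_e(f)$ is total. A team (finite family) of learners identifies $\Gamma$ if on every $g\in\mathrm{dom}(\Gamma)$ at least one of its members identifies $\Gamma$. For $P,Q\subseteq\mathbb N^{\mathbb N}$ write $P\le^1_1Q$ (respectively $P\le^{<\omega}_\omega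 Q$, $P\le^\omega_1Q$) if there is a partial function $\Gamma$, defined on $Q$ and mapping $Q$ into $P$, which is computable (respectively identified by some finite team of learners; such that $\Gamma(g)\le_Tg$ for all $g\in\mathrm{dom}(\Gamma)$). $P<^1_1Q$ means $P\le^1_1Q$ and $Q\not\le^1_1P$, and $\equiv^\alpha_\beta$ means $\le^\alpha_\beta$ in both directions. For a tree $T\subseteq\mathbb N^{<\mathbb N}$ let $[T]$ be its set of infinite paths. If $T,S$ are computable trees with $[T]=Q$ and $[S]=P$, then the hyperconcatenation $Q\circledast P$ (formed with $T$ and $S$) is the set of infinite paths of the tree of all strings $$\rho_0{}^\frown\langle\tau(0)\rangle^\frown\rho_1{}^\frown\langle\tau(1)\rangle^\frown\cdots{}^\frown\rho_{n-1}{}^\frown\langle\tau(n-1)\rangle^\frown\sigma,$$ where $n\in\mathbb N$, $\tau\in T$ has length $n$, $\rho_0,\dots,\rho_{n-1}$ are leaves of $S$, and $\sigma\in S$. Theorem. (1) For every $k\ge2$, there is a computable tree $T\subseteq\{0,\dots,k-1\}^{<\mathbb N}$ with $[T]=\mathsf{DNR}_k$, and $\mathsf{DNR}_k\circledast\mathsf{DNR}_k<^1_1\mathsf{DNR}_{k^2}$,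 whichever computable trees $T,S\subseteq\{0,\dots,k-1\}^{<\mathbb N}$ with $[T]=[S]=\mathsf{DNR}_k$ are used to form the hyperconcatenation. (2) $\mathsf{DNR}_k\equiv^{<\omega}_\omega\mathsf{DNR}_2$ for every $k\ge2$. (3) For every $k\in\mathbb N$, $\mathsf{DNR}_k\le^{<\omega}_\omega\mathsf{DNR}_{k^2}$ is witnessed by a team of two learners, one confident and one eventually-Popperian. (4) In particular, $\mathsf{DNR}_k\equiv^\omega_1\mathsf{DNR}_2$ for every $k\ge2$. -/

import Mathlib

namespace DNR

open Filter

/-- The initial segment `f ↾ n = ⟨f 0, …, f (n - 1)⟩`. -/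
def pre (f : ℕ → ℕ) (n : ℕ) : List ℕ := (List.range n).map f

/-! ### Turing functionals -/

/-- The value `Φ_e(f; n)` of the `e`-th Turing functional with oracle `f` at `n`, where `Φ_e` is
presented by the `e`-th partial computable function `φ_e` acting on pairs (finite piece of the
oracle, input): dovetail over all pairs `(t, s)` and return the first value that `φ_e` outputs
within `s` steps on `(f ↾ t, n)`.
An oracle machine `M` is obtained from the `φ_e` which on `(σ, n)` simulates `M` on `n` for `|σ|`
steps with oracle `σ`, and diverges if `M` does not halt by then or queries a number `≥ |σ|`; so
`e ↦ Φ_e` is an effective enumeration of all partial computable functionals. -/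
def turingFunctional (e : ℕ) (f : ℕ → ℕ) (n : ℕ) : Part ℕ :=
  Nat.rfindOpt fun m =>
    Nat.Partrec.Code.evaln m.unpair.2 (Denumerable.ofNat Nat.Partrec.Code e)
      (Nat.pair (Encodable.encode (pre f m.unpair.1)) n)

/-- `Φ_e(g)` is total and equal to `f`. -/
def Computes (e : ℕ) (g f : ℕ → ℕ) : Prop :=
  ∀ n, f n ∈ turingFunctional e g n

/-! ### Learners -/

/-- A learner: a total computable function `ℕ^{<ℕ} → ℕ`, whose values are indices of Turing
functionals. -/
def IsLearner (Ψ : List ℕ → ℕ) : Prop := Computable Ψ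

/-- `lim_n Ψ(g ↾ n)` converges to `e`. -/
def LimIs (Ψ : List ℕ → ℕ) (g : ℕ → ℕ) (e : ℕ) : Prop :=
  ∀ᶠ n in atTop, Ψ (pre g n) = e

/-- A learner is confident if it converges on every `f ∈ ℕ^ℕ`. -/
def IsConfident (Ψ : List ℕ → ℕ) : Prop :=
  ∀ f : ℕ → ℕ, ∃ e, LimIs Ψ f e

/-- A learner is eventually-Popperian if, for every `f ∈ ℕ^ℕ`, the function
`Φ_{lim_s Ψ(f ↾ s)}(f)` is total whenever `lim_s Ψ(f ↾ s)` converges. -/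
def IsEventuallyPopperian (Ψ : List ℕ → ℕ) : Prop :=
  ∀ (f : ℕ → ℕ) (e : ℕ), LimIs Ψ f e → ∀ n, (turingFunctional e f n).Dom

/-- The partial function `Γ :⊆ ℕ^ℕ → ℕ^ℕ` is identified by the learner `Ψ` on `g`:
`lim_n Ψ(g ↾ n)` converges to some `e`, and `Φ_e(g) = Γ(g)`. -/
def IdentifiedOn (Γ : (ℕ → ℕ) →. (ℕ → ℕ)) (Ψ : List ℕ → ℕ) (g : ℕ → ℕ) : Prop :=
  ∃ e, LimIs Ψ g e ∧ ∃ f ∈ Γ g, Computes e g f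

/-! ### Classes of partial functions on Baire space and their reducibilities -/

/-- `(1,1)`-computable: `Γ` is (the restriction to its domain of) a Turing functional. -/
def Computable11 (Γ : (ℕ → ℕ) →. (ℕ → ℕ)) : Prop :=
  ∃ e, ∀ g, ∀ f ∈ Γ g, Computes e g f

/-- `Γ` is identified by the team of learners `Ψ_i`, `i < b`: on each `g ∈ dom Γ`, at least one of
them identifies `Γ`. -/
def IdentifiedByTeam {b : ℕ} (Γ : (ℕ → ℕ) →. (ℕ → ℕ)) (Ψ : Fin b → List ℕ → ℕ) : Prop :=
  (∀ i, IsLearner (Ψ i)) ∧ ∀ g ∈ Γ.Dom, ∃ i, IdentifiedOn Γ (Ψ i) g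

/-- `(<ω,ω)`-computable: learnable by a finite team of learners. -/
def ComputableFinOmega (Γ : (ℕ → ℕ) →. (ℕ → ℕ)) : Prop :=
  ∃ (b : ℕ) (Ψ : Fin b → List ℕ → ℕ), IdentifiedByTeam Γ Ψ

/-- `(ω,1)`-computable: nonuniformly computable, `Γ(g) ≤_T g` for every `g ∈ dom Γ`. -/
def ComputableOmega1 (Γ : (ℕ → ℕ) →. (ℕ → ℕ)) : Prop :=
  ∀ g, ∀ f ∈ Γ g, TuringReducible (fun n => Part.some (f n)) (fun n => Part.some (g n))

/-- `Γ` is a function from `Q` into `P`: it is defined on `Q` and maps `Q` into `P`. -/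
def MapsInto (Γ : (ℕ → ℕ) →. (ℕ → ℕ)) (Q P : Set (ℕ → ℕ)) : Prop :=
  ∀ g ∈ Q, ∃ f ∈ Γ g, f ∈ P

/-- `P ≤_F Q`: some function in the class `F` maps `Q` into `P`. -/
def Red (F : ((ℕ → ℕ) →. (ℕ → ℕ)) → Prop) (P Q : Set (ℕ → ℕ)) : Prop :=
  ∃ Γ, F Γ ∧ MapsInto Γ Q P

/-- `P <_F Q`. -/
def StrictRed (F : ((ℕ → ℕ) →. (ℕ → ℕ)) → Prop) (P Q : Set (ℕ → ℕ)) : Prop :=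
  Red F P Q ∧ ¬ Red F Q P

/-- `P ≡_F Q`. -/
def EquivRed (F : ((ℕ → ℕ) →. (ℕ → ℕ)) → Prop) (P Q : Set (ℕ → ℕ)) : Prop :=
  Red F P Q ∧ Red F Q P

/-! ### Trees and hyperconcatenation -/

/-- The set `[T]` of infinite paths of `T`. -/
def body (T : Set (List ℕ)) : Set (ℕ → ℕ) := {f | ∀ n, pre f n ∈ T}

/-- The leaves (dead ends) of `T`. -/
def leaves (T : Set (List ℕ)) : Set (List ℕ) :=
  {σ | σ ∈ T ∧ ¬ ∃ τ ∈ T, σ <+: τ ∧ τ ≠ σ}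

/-- `T ⊆ k^{<ℕ}` is a computable tree with `[T] = P`. -/
structure IsComputableTreeOf (k : ℕ) (T : Set (List ℕ)) (P : Set (ℕ → ℕ)) : Prop where
  closed : ∀ σ τ : List ℕ, σ <+: τ → τ ∈ T → σ ∈ T
  bounded : ∀ σ ∈ T, ∀ i ∈ σ, i < k
  computable : ComputablePred fun σ : List ℕ => σ ∈ T
  body_eq : body T = P

/-- The tree of the iterated concatenation of `S` along the tree `T`. Concatenating something after
the tree `S` means attaching it at the leaves of `S`; so the nodes are the strings
`ρ₀ ⟨τ(0)⟩ ρ₁ ⟨τ(1)⟩ … ρ_{n-1} ⟨τ(n-1)⟩ σ` with `τ ∈ T`, `|τ| = n`, leaves `ρ_i` of `S`, and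
`σ ∈ S`. Here `bs` is the list of the pairs `(ρ_i, τ(i))`. -/
def hyperTree (T S : Set (List ℕ)) : Set (List ℕ) :=
  {γ | ∃ (bs : List (List ℕ × ℕ)) (σ : List ℕ),
    bs.map Prod.snd ∈ T ∧ (∀ b ∈ bs, b.1 ∈ leaves S) ∧ σ ∈ S ∧
      γ = (bs.map fun b => b.1 ++ [b.2]).flatten ++ σ}

/-- The hyperconcatenation `Q ⊛ P`, where `T` and `S` are the trees of `Q` and `P`. -/
def hyperconcat (T S : Set (List ℕ)) : Set (ℕ → ℕ) := body (hyperTree T S)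

/-! ### Diagonally noncomputable functions -/

/-- `DNR_k`: the functions `f : ℕ → k` with `f(e) ≠ φ_e(e)` whenever `φ_e(e)` converges. -/
def DNRSet (k : ℕ) : Set (ℕ → ℕ) :=
  {f | ∀ e, f e < k ∧ f e ∉ (Denumerable.ofNat Nat.Partrec.Code e).eval e}

end DNR

namespace DNR

open Filter
open Nat.Partrec (Code)
open Nat.Partrec.Code (evaln eval)

/-! ### Initial segments -/

/-! The s-m-n theorem gives a computable `v` with `φ_{v(a,b)}(v(a,b)) = k·φ_a(a) + φ_b(b)`. For `g`
in `DNR_{k²}` write `g(v(e,i)) = k·x + y`. The equations `x = φ_e(e)` and `y = φ_i(i)` cannot both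
hold. So in row `e`, either some `i` has `y = φ_i(i)`, which a search finds and which certifies `x ≠
φ_e(e)`, or the remainders `y` of the whole row form an element of `DNR_k`.

If the search succeeds in every row, the quotients `x` found are in `DNR_k`, and one fixed index
computes them. Otherwise the least row where it fails is learnable in the limit, and its remainders
are computed by an index that is total on every oracle. This is the team of
`exists_confident_popperian_team`. Teams compose (`TeamReduces.trans`), so iterated squaring gives
`red_finOmega_DNRSet_two`; an identifying index yields Turing reducibility.

Hyperconcatenation makes the case distinction unnecessary (`red_hyperconcat`): copy the remainders
of row `e` along `S`; if they leave `S`, go on to a leaf, append the quotient that the search then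
finds, and pass to row `e + 1`.

Conversely (`not_red_hyperconcat`), since `DNR_k` has no computable element, every node of `S`
extends to a leaf, and after a leaf a path of the hyperconcatenation can continue. Every node of `S`
thus lies on such a path, and the recursion theorem diagonalizes against any functional by a search
through `S`. -/

@[simp] theorem pre_length (f : ℕ → ℕ) (n : ℕ) : (pre f n).length = n := by simp [pre]

@[simp] theorem pre_zero (f : ℕ → ℕ) : pre f 0 = [] := rfl

theorem pre_succ (f : ℕ → ℕ) (n : ℕ) : pre f (n + 1) = pre f n ++ [f n] := by
  simp [pre, List.range_succ]

theorem pre_getElem? (f : ℕ → ℕ) (n i : ℕ) :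
    (pre f n)[i]? = if i < n then some (f i) else none := by
  by_cases h : i < n <;> simp [pre, h]

theorem pre_getElem?_eq_some {f : ℕ → ℕ} {n i v : ℕ} :
    (pre f n)[i]? = some v ↔ i < n ∧ f i = v := by
  rw [pre_getElem?]; split_ifs with h <;> simp [h]

@[simp] theorem pre_getElem (f : ℕ → ℕ) (n i : ℕ) (h : i < (pre f n).length) :
    (pre f n)[i] = f i := by
  simp [pre]

theorem pre_take (f : ℕ → ℕ) {m n : ℕ} (h : m ≤ n) : (pre f n).take m = pre f m := by
  simp [pre, ← List.map_take, List.take_range, h]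

theorem pre_prefix (f : ℕ → ℕ) {m n : ℕ} (h : m ≤ n) : pre f m <+: pre f n := by
  rw [← pre_take f h]; exact List.take_prefix _ _

theorem eq_pre_of_prefix {f : ℕ → ℕ} {n : ℕ} {σ : List ℕ} (h : σ <+: pre f n) :
    σ = pre f σ.length := by
  have hl : σ.length ≤ n := by simpa using h.length_le
  rw [← pre_take f hl]; exact List.prefix_iff_eq_take.1 h

theorem pre_map (f : ℕ → ℕ) (φ : ℕ → ℕ) (n : ℕ) :
    (pre f n).map φ = pre (fun i => φ (f i)) n := by
  simp [pre, Function.comp_def]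

theorem pre_congr {f g : ℕ → ℕ} {n : ℕ} (h : ∀ i < n, f i = g i) : pre f n = pre g n :=
  List.map_congr_left fun i hi => h i (List.mem_range.1 hi)

/-! ### Indices of Turing functionals -/

theorem exists_of_mem_turingFunctional {e : ℕ} {g : ℕ → ℕ} {n v : ℕ}
    (h : v ∈ turingFunctional e g n) :
    ∃ t s, evaln s (Denumerable.ofNat Code e) (Nat.pair (Encodable.encode (pre g t)) n) = some v := by
  obtain ⟨m, hm⟩ := Nat.rfindOpt_spec h
  exact ⟨_, _, hm⟩

theorem turingFunctional_dom {e : ℕ} {g : ℕ → ℕ} {n t s v : ℕ}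
    (h : evaln s (Denumerable.ofNat Code e) (Nat.pair (Encodable.encode (pre g t)) n) = some v) :
    (turingFunctional e g n).Dom :=
  Nat.rfindOpt_dom.2 ⟨Nat.pair t s, v, by simpa using h⟩

theorem Computes.unique {e : ℕ} {g f f' : ℕ → ℕ} (h : Computes e g f) (h' : Computes e g f') :
    f = f' :=
  funext fun n => Part.mem_unique (h n) (h' n)

/-- The s-m-n theorem for Turing functionals. -/
theorem exists_index {F : ℕ → List ℕ → ℕ →. ℕ}
    (hF : Partrec fun p : ℕ × List ℕ × ℕ => F p.1 p.2.1 p.2.2) :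
    ∃ idx : ℕ → ℕ, Computable idx ∧ ∀ a g n,
      (∀ v ∈ turingFunctional (idx a) g n, ∃ t, v ∈ F a (pre g t) n) ∧
      ∀ t, (F a (pre g t) n).Dom → (turingFunctional (idx a) g n).Dom := by
  have hG : Partrec fun x : ℕ => F x.unpair.1 (Denumerable.ofNat (List ℕ) x.unpair.2.unpair.1)
      x.unpair.2.unpair.2 := by
    have h1 : Computable fun x : ℕ => x.unpair.1 := Computable.fst.comp Computable.unpair
    have h2 : Computable fun x : ℕ => x.unpair.2 := Computable.snd.comp Computable.unpair
    exact hF.comp (h1.pair (((Computable.ofNat (List ℕ)).comp (h1.comp h2)).pair (h2.comp h2)))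
  obtain ⟨c, hc⟩ := Code.exists_code.1 (Partrec.nat_iff.1 hG)
  have key : ∀ a σ n v, v ∈ F a σ n ↔ v ∈ eval (Denumerable.ofNat Code
      (Encodable.encode (c.curry a))) (Nat.pair (Encodable.encode σ) n) := by
    intro a σ n v
    rw [Denumerable.ofNat_encode, Code.eval_curry, hc]
    simp
  refine ⟨fun a => Encodable.encode (c.curry a), ?_, fun a g n => ⟨fun v hv => ?_, fun t ht => ?_⟩⟩
  · exact Computable.encode.comp (Code.primrec₂_curry.to_comp.comp (Computable.const c)
      Computable.id)
  · obtain ⟨t, s, h⟩ := exists_of_mem_turingFunctional hv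
    exact ⟨t, (key _ _ _ _).2 (Code.evaln_sound h)⟩
  · obtain ⟨v, hv⟩ := Part.dom_iff_mem.1 ht
    obtain ⟨s, hs⟩ := Code.evaln_complete.1 ((key _ _ _ _).1 hv)
    exact turingFunctional_dom hs

/-- An index from `exists_index` may receive different candidate values from different pieces of the
oracle. Only a property `A` shared by all candidates is therefore transferred to the computed
function. -/
theorem exists_computes {e : ℕ} {g : ℕ → ℕ} {A : ℕ → ℕ → Prop}
    (hdom : ∀ n, (turingFunctional e g n).Dom)
    (hA : ∀ n, ∀ v ∈ turingFunctional e g n, A n v) :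
    ∃ f, Computes e g f ∧ ∀ n, A n (f n) :=
  ⟨fun n => (turingFunctional e g n).get (hdom n), fun _ => Part.get_mem _,
    fun n => hA n _ (Part.get_mem _)⟩

/-- The s-m-n theorem for Turing functionals given by a computable function with optional values. -/
theorem exists_index_option {F : ℕ → List ℕ → ℕ → Option ℕ}
    (hF : Computable fun p : ℕ × List ℕ × ℕ => F p.1 p.2.1 p.2.2) :
    ∃ idx : ℕ → ℕ, Computable idx ∧ ∀ a g n,
      (∀ v ∈ turingFunctional (idx a) g n, ∃ t, F a (pre g t) n = some v) ∧
      ∀ t v, F a (pre g t) n = some v → (turingFunctional (idx a) g n).Dom := by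
  obtain ⟨idx, h1, h2⟩ := exists_index (F := fun a σ n => (F a σ n : Part ℕ)) hF.ofOption
  refine ⟨idx, h1, fun a g n => ⟨fun v hv => ?_, fun t v h => ?_⟩⟩
  · simpa using (h2 a g n).1 v hv
  · exact (h2 a g n).2 t (by simp [h])

/-! ### Reducibilities in terms of indices -/

theorem red_computable11_iff {P Q : Set (ℕ → ℕ)} :
    Red Computable11 P Q ↔ ∃ e, ∀ g ∈ Q, ∃ f, Computes e g f ∧ f ∈ P := by
  constructor
  · rintro ⟨Γ, ⟨e, he⟩, hΓ⟩
    refine ⟨e, fun g hg => ?_⟩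
    obtain ⟨f, hf, hP⟩ := hΓ g hg
    exact ⟨f, he g f hf, hP⟩
  · rintro ⟨e, he⟩
    -- The domain consists of all oracles on which `Φ_e` is total; it may be larger than `Q`.
    refine ⟨fun g => ⟨∃ f, Computes e g f, fun h => h.choose⟩, ⟨e, ?_⟩, fun g hg => ?_⟩
    · rintro g f ⟨h, rfl⟩
      exact h.choose_spec
    · obtain ⟨f, hf, hP⟩ := he g hg
      have h : ∃ f, Computes e g f := ⟨f, hf⟩
      exact ⟨f, ⟨h, h.choose_spec.unique hf⟩, hP⟩

/-- The team of the learners `Ψ i` reduces `P` to `Q`. -/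
def TeamReduces {ι : Type*} (Ψ : ι → List ℕ → ℕ) (P Q : Set (ℕ → ℕ)) : Prop :=
  (∀ i, Computable (Ψ i)) ∧
    ∀ g ∈ Q, ∃ i e, LimIs (Ψ i) g e ∧ ∃ f, Computes e g f ∧ f ∈ P

theorem TeamReduces.exists_identified {b : ℕ} {Ψ : Fin b → List ℕ → ℕ} {P Q : Set (ℕ → ℕ)}
    (h : TeamReduces Ψ P Q) :
    ∃ Γ : (ℕ → ℕ) →. (ℕ → ℕ), MapsInto Γ Q P ∧ IdentifiedByTeam Γ Ψ := by
  have h2 : ∀ g, g ∈ Q → ∃ f, f ∈ P ∧ ∃ i e, LimIs (Ψ i) g e ∧ Computes e g f := by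
    intro g hg
    obtain ⟨i, e, h1, f, h2, h3⟩ := h.2 g hg
    exact ⟨f, h3, i, e, h1, h2⟩
  choose! F hF using h2
  refine ⟨fun g => ⟨g ∈ Q, fun _ => F g⟩, fun g hg => ⟨F g, ⟨hg, rfl⟩, (hF g hg).1⟩, h.1,
    fun g hg => ?_⟩
  obtain ⟨-, i, e, h1, h2⟩ := hF g hg
  exact ⟨i, e, h1, F g, ⟨hg, rfl⟩, h2⟩

theorem red_computableFinOmega_iff {P Q : Set (ℕ → ℕ)} :
    Red ComputableFinOmega P Q ↔ ∃ (b : ℕ) (Ψ : Fin b → List ℕ → ℕ), TeamReduces Ψ P Q := by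
  constructor
  · rintro ⟨Γ, ⟨b, Ψ, h1, h2⟩, hΓ⟩
    refine ⟨b, Ψ, h1, fun g hg => ?_⟩
    obtain ⟨f, hf, hP⟩ := hΓ g hg
    obtain ⟨i, e, hlim, f', hf', hc⟩ := h2 g (Part.dom_iff_mem.2 ⟨f, hf⟩)
    exact ⟨i, e, hlim, f', hc, Part.mem_unique hf hf' ▸ hP⟩
  · rintro ⟨b, Ψ, h⟩
    obtain ⟨Γ, h1, h2⟩ := h.exists_identified
    exact ⟨Γ, ⟨b, Ψ, h2⟩, h1⟩

/-! ### Turing functionals and Turing reducibility -/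

/-- Primitive recursion relative to `g`, appending one oracle value at a time. It supplies the
finite pieces of the oracle on which a functional is run. -/
theorem recursiveIn_encode_pre (g : ℕ → ℕ) :
    Nat.RecursiveIn {fun n => Part.some (g n)}
      fun n => Part.some (Encodable.encode (pre g n)) := by
  set O : Set (ℕ →. ℕ) := {fun n => Part.some (g n)}
  have hstep : Nat.Primrec fun x : ℕ => Encodable.encode
      (Denumerable.ofNat (List ℕ) x.unpair.1 ++ [x.unpair.2]) := by
    refine Primrec.nat_iff.1 (Primrec.encode.comp (Primrec.list_concat.comp
      ((Primrec.ofNat (List ℕ)).comp (Primrec.fst.comp Primrec.unpair))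
      (Primrec.snd.comp Primrec.unpair)))
  have hh : Nat.RecursiveIn O fun p => Part.some (Encodable.encode
      (Denumerable.ofNat (List ℕ) p.unpair.2.unpair.2 ++ [g p.unpair.2.unpair.1])) := by
    have ho : Nat.RecursiveIn O fun n => Part.some (g n) := .oracle _ rfl
    have h1 : Nat.RecursiveIn O fun p => Part.some p.unpair.2.unpair.1 :=
      (Nat.RecursiveIn.comp .left .right).of_eq fun n => by simp
    have h2 : Nat.RecursiveIn O fun p => Part.some p.unpair.2.unpair.2 :=
      (Nat.RecursiveIn.comp .right .right).of_eq fun n => by simp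
    refine (hstep.recursiveIn.comp (h2.pair (ho.comp h1))).of_eq fun n => ?_
    simp [Seq.seq]
  have hz : Nat.RecursiveIn O fun _ => Part.some (Encodable.encode ([] : List ℕ)) :=
    (Nat.Primrec.const (Encodable.encode ([] : List ℕ))).recursiveIn
  have hp := Nat.RecursiveIn.prec hz hh
  -- The recursion scheme expects a pair of a parameter and a counter; the parameter is a dummy `0`.
  have hpair : Nat.RecursiveIn O fun n => Part.some (Nat.pair 0 n) :=
    (Primrec.nat_iff.1 (Primrec₂.natPair.comp (Primrec.const 0) Primrec.id)).recursiveIn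
  refine (hp.comp hpair).of_eq fun n => ?_
  simp only [Part.bind_eq_bind, Part.bind_some, Nat.unpair_pair]
  induction n with
  | zero => rfl
  | succ n ih =>
    simp only [ih, Part.bind_some, Denumerable.ofNat_encode, pre_succ]

theorem Computes.turingReducible {e : ℕ} {g f : ℕ → ℕ} (h : Computes e g f) :
    TuringReducible (fun n => Part.some (f n)) fun n => Part.some (g n) := by
  refine RecursiveIn.iff_nat.2 ?_
  set O : Set (ℕ →. ℕ) := {fun n => Part.some (g n)}
  let K : ℕ → ℕ → ℕ → Option ℕ := fun n m x =>
    evaln m.unpair.2 (Denumerable.ofNat Code e) (Nat.pair x n)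
  let w : ℕ → ℕ := fun m => Encodable.encode (pre g m.unpair.1)
  have hK : Primrec fun p : ℕ × ℕ × ℕ => K p.1 p.2.1 p.2.2 :=
    Code.primrec_evaln.comp (((Primrec.snd.comp (Primrec.unpair.comp
      (Primrec.fst.comp Primrec.snd))).pair (Primrec.const _)).pair
      (Primrec₂.natPair.comp (Primrec.snd.comp Primrec.snd) Primrec.fst))
  have hK' : Primrec fun x : ℕ => K x.unpair.1.unpair.1 x.unpair.1.unpair.2 x.unpair.2 := by
    have h1 : Primrec fun x : ℕ => x.unpair.1 := Primrec.fst.comp Primrec.unpair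
    have h2 : Primrec fun x : ℕ => x.unpair.2 := Primrec.snd.comp Primrec.unpair
    exact hK.comp ((h1.comp h1).pair ((h2.comp h1).pair h2))
  have hw : Nat.RecursiveIn O fun x => Part.some (Nat.pair x (w x.unpair.2)) := by
    have hid : Nat.RecursiveIn O fun x => Part.some x :=
      (Primrec.nat_iff.1 Primrec.id).recursiveIn
    refine (hid.pair ((recursiveIn_encode_pre g).comp
      (Nat.RecursiveIn.comp .left .right))).of_eq fun n => ?_
    simp [Seq.seq, w]
  -- Unbounded search looks for a zero, so success is coded by `0`.
  have htest : Nat.RecursiveIn O fun x => Part.some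
      (if (K x.unpair.1 x.unpair.2 (w x.unpair.2)).isSome then 0 else 1) := by
    have hp : Primrec fun x : ℕ =>
        bif (K x.unpair.1.unpair.1 x.unpair.1.unpair.2 x.unpair.2).isSome then 0 else 1 :=
      Primrec.cond (Primrec.option_isSome.comp hK') (Primrec.const 0) (Primrec.const 1)
    refine ((Primrec.nat_iff.1 hp).recursiveIn.comp hw).of_eq fun n => ?_
    simp [Bool.cond_eq_ite]
  have hval : Nat.RecursiveIn O fun x => Part.some
      ((K x.unpair.1 x.unpair.2 (w x.unpair.2)).getD 0) := by
    have hp := Primrec.option_getD.comp hK' (Primrec.const 0)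
    refine ((Primrec.nat_iff.1 hp).recursiveIn.comp hw).of_eq fun n => ?_
    simp
  have hid : Nat.RecursiveIn O fun x => Part.some x :=
    (Primrec.nat_iff.1 Primrec.id).recursiveIn
  -- The search returns only the successful stage, so the value is recomputed at that stage.
  refine (hval.comp (hid.pair (Nat.RecursiveIn.rfind htest))).of_eq_tot fun n => ?_
  obtain ⟨m, hm, hv⟩ := Part.mem_bind_iff.1 (h n)
  rw [Part.mem_coe] at hv
  have hfind : m ∈ Nat.rfind fun m' => (Part.some (decide
      ((if (K n m' (w m')).isSome then 0 else 1) = 0)) : Part Bool) := by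
    convert hm using 2
    simp only [Part.coe_some, K, w]
    congr 1
    funext m'
    congr 1
    split_ifs with h <;> simp_all
  simp only [Nat.unpair_pair, Part.map_eq_map, Part.map_some, Part.bind_eq_bind, Part.bind_some,
    Seq.seq, Part.mem_bind_iff, Part.mem_map_iff]
  refine ⟨Nat.pair n m, ⟨m, hfind, rfl⟩, ?_⟩
  simp only [Nat.unpair_pair, K, w]
  rw [show evaln _ _ _ = some (f n) from hv]
  simp

/-! ### Diagonally noncomputable functions -/

theorem mem_DNRSet {k : ℕ} {f : ℕ → ℕ} : f ∈ DNRSet k ↔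
    ∀ e, f e < k ∧ ∀ s, evaln s (Denumerable.ofNat Code e) e ≠ some (f e) := by
  refine forall_congr' fun e => and_congr_right fun _ => ?_
  rw [Code.evaln_complete]
  simp

theorem DNRSet_mono {k l : ℕ} (h : k ≤ l) : DNRSet k ⊆ DNRSet l :=
  fun _ hf e => ⟨(hf e).1.trans_le h, (hf e).2⟩

theorem exists_evaln_of_not_mem {k : ℕ} {f : ℕ → ℕ} (hk : ∀ e, f e < k) (h : f ∉ DNRSet k) :
    ∃ i s, evaln s (Denumerable.ofNat Code i) i = some (f i) := by
  by_contra! hc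
  exact h (mem_DNRSet.2 fun e => ⟨hk e, hc e⟩)

/-- An index whose diagonal value is `k * φ_a(a) + φ_b(b)`. -/
theorem exists_diagonal_pair (k : ℕ) : ∃ v : ℕ → ℕ → ℕ, Computable₂ v ∧ ∀ a b x y,
    x ∈ (Denumerable.ofNat Code a).eval a → y ∈ (Denumerable.ofNat Code b).eval b →
      k * x + y ∈ (Denumerable.ofNat Code (v a b)).eval (v a b) := by
  have h1 : Computable fun x : ℕ => x.unpair.1 := Computable.fst.comp Computable.unpair
  have h2 : Computable fun x : ℕ => x.unpair.2 := Computable.snd.comp Computable.unpair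
  have hd : Partrec fun x : ℕ => (Denumerable.ofNat Code x).eval x :=
    Code.eval_part.comp (Computable.ofNat Code) Computable.id
  have hadd : Computable fun p : (ℕ × ℕ) × ℕ => k * p.1.2 + p.2 :=
    (Primrec.nat_add.comp (Primrec.nat_mul.comp (Primrec.const k)
      (Primrec.snd.comp Primrec.fst)) Primrec.snd).to_comp
  have hG : Partrec fun p : ℕ =>
      ((Denumerable.ofNat Code p.unpair.1.unpair.1).eval p.unpair.1.unpair.1).bind fun x =>
        ((Denumerable.ofNat Code p.unpair.1.unpair.2).eval p.unpair.1.unpair.2).map fun y =>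
          k * x + y :=
    (hd.comp (h1.comp h1)).bind
      ((hd.comp ((h2.comp h1).comp Computable.fst)).map hadd)
  obtain ⟨c, hc⟩ := Code.exists_code.1 (Partrec.nat_iff.1 hG)
  refine ⟨fun a b => Encodable.encode (c.curry (Nat.pair a b)), ?_, fun a b x y hx hy => ?_⟩
  · exact Computable.encode.comp (Code.primrec₂_curry.to_comp.comp (Computable.const c)
      (Primrec₂.natPair.to_comp.comp Computable.fst Computable.snd))
  · rw [Denumerable.ofNat_encode, Code.eval_curry, hc]
    simp only [Nat.unpair_pair, Part.mem_bind_iff, Part.mem_map_iff]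
    exact ⟨x, hx, y, hy, rfl⟩

/-! ### Bounded searches along the rows of an oracle -/

/-- The first of the values `f 0, …, f (n - 1)` that is defined. -/
def firstSome {β : Type*} (f : ℕ → Option β) (n : ℕ) : Option β :=
  n.rec none fun m ih => ih.or (f m)

theorem firstSome_eq_some {β : Type*} {f : ℕ → Option β} {n : ℕ} {b : β} :
    firstSome f n = some b ↔ ∃ m < n, f m = some b ∧ ∀ j < m, f j = none := by
  have hnone : ∀ n, firstSome f n = none ↔ ∀ j < n, f j = none := by
    intro n
    induction n with
    | zero => simp [firstSome]
    | succ n ih =>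
      rw [show firstSome f (n + 1) = (firstSome f n).or (f n) from rfl, Option.or_eq_none_iff, ih]
      exact Nat.forall_lt_succ_right.symm
  induction n with
  | zero => simp [firstSome]
  | succ n ih =>
    rw [show firstSome f (n + 1) = (firstSome f n).or (f n) from rfl, Option.or_eq_some_iff,
      hnone, Nat.exists_lt_succ_right, and_comm (a := ∀ j < n, f j = none)]
    exact or_congr_left ih

theorem computable_firstSome {α β : Type*} [Primcodable α] [Primcodable β]
    {f : α → ℕ → Option β} {n : α → ℕ} (hf : Computable₂ f) (hn : Computable n) :
    Computable fun a => firstSome (f a) (n a) := by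
  refine Computable.nat_rec (σ := Option β) hn (Computable.const none)
    (h := fun a p => p.2.or (f a p.1)) ?_
  have h1 : Computable fun p : α × ℕ × Option β => f p.1 p.2.1 :=
    hf.comp Computable.fst (Computable.fst.comp Computable.snd)
  have h2 : Computable fun p : α × ℕ × Option β => p.2.2 := Computable.snd.comp Computable.snd
  have h3 : Computable₂ fun (_ : α × ℕ × Option β) (b : β) => some b :=
    Computable.option_some.comp Computable.snd
  refine (Computable.option_casesOn h2 h1 h3).of_eq ?_
  rintro ⟨a, m, _ | b⟩ <;> rfl

/-- The `e`-th row of the oracle `g`, whose entries are stored at the places `v e i`. -/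
def row (v : ℕ → ℕ → ℕ) (g : ℕ → ℕ) (e : ℕ) : ℕ → ℕ := fun i => g (v e i)

/-- The first `m` entries of the `e`-th row, if the finite piece `σ` of the oracle has them. -/
def rowPre (v : ℕ → ℕ → ℕ) (σ : List ℕ) (e m : ℕ) : Option (List ℕ) :=
  m.rec (some []) fun j ih => ih.bind fun r => σ[v e j]?.map fun x => r ++ [x]

theorem rowPre_eq_some {v : ℕ → ℕ → ℕ} {g : ℕ → ℕ} {t e m : ℕ} {r : List ℕ} :
    rowPre v (pre g t) e m = some r ↔ (∀ j < m, v e j < t) ∧ r = pre (row v g e) m := by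
  induction m generalizing r with
  | zero => simp [rowPre, eq_comm]
  | succ m ih =>
    rw [show rowPre v (pre g t) e (m + 1) = (rowPre v (pre g t) e m).bind fun r =>
      (pre g t)[v e m]?.map fun x => r ++ [x] from rfl]
    simp only [Option.bind_eq_some_iff, ih, Option.map_eq_some_iff, pre_getElem?_eq_some, pre_succ,
      Nat.forall_lt_succ_right]
    constructor
    · rintro ⟨r', ⟨h1, rfl⟩, x, ⟨h2, rfl⟩, rfl⟩
      exact ⟨⟨h1, h2⟩, rfl⟩
    · rintro ⟨⟨h1, h2⟩, rfl⟩
      exact ⟨_, ⟨h1, rfl⟩, _, ⟨h2, rfl⟩, rfl⟩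

theorem eventually_rowPre (v : ℕ → ℕ → ℕ) (g : ℕ → ℕ) (e m : ℕ) :
    ∀ᶠ t in atTop, rowPre v (pre g t) e m = some (pre (row v g e) m) := by
  have h : ∀ᶠ t in atTop, ∀ j < m, v e j < t :=
    (Set.finite_lt_nat m).eventually_all.2 fun j _ => eventually_gt_atTop _
  exact h.mono fun t ht => rowPre_eq_some.2 ⟨ht, rfl⟩

theorem computable_rowPre {v : ℕ → ℕ → ℕ} (hv : Computable₂ v) :
    Computable fun p : List ℕ × ℕ × ℕ => rowPre v p.1 p.2.1 p.2.2 := by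
  have hm : Computable fun p : List ℕ × ℕ × ℕ => p.2.2 := Computable.snd.comp Computable.snd
  refine Computable.nat_rec (σ := Option (List ℕ)) hm (Computable.const (some []))
    (h := fun p q => q.2.bind fun r => p.1[v p.2.1 q.1]?.map fun x => r ++ [x]) ?_
  have hx : Computable fun q : ((List ℕ × ℕ × ℕ) × ℕ × Option (List ℕ)) × List ℕ =>
      q.1.1.1[v q.1.1.2.1 q.1.2.1]? :=
    Computable.list_getElem?.comp (Computable.fst.comp (Computable.fst.comp Computable.fst))
      (hv.comp (Computable.fst.comp (Computable.snd.comp (Computable.fst.comp Computable.fst)))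
        (Computable.fst.comp (Computable.snd.comp Computable.fst)))
  have hr : Computable₂ fun (q : ((List ℕ × ℕ × ℕ) × ℕ × Option (List ℕ)) × List ℕ) (x : ℕ) =>
      q.2 ++ [x] :=
    Computable.list_concat.comp (Computable.snd.comp Computable.fst) Computable.snd
  have h0 : Computable fun q : (List ℕ × ℕ × ℕ) × ℕ × Option (List ℕ) => q.2.2 :=
    Computable.snd.comp Computable.snd
  exact Computable.option_bind h0 (Computable.option_map hx hr)

/-- `b` is the value of `D` at the shortest initial segment of `h` at which `D` is defined. -/
def FirstHit {β : Type*} (D : List ℕ → Option β) (h : ℕ → ℕ) (b : β) : Prop :=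
  ∃ m, D (pre h m) = some b ∧ ∀ j < m, D (pre h j) = none

theorem FirstHit.unique {β : Type*} {D : List ℕ → Option β} {h : ℕ → ℕ} {b c : β}
    (hb : FirstHit D h b) (hc : FirstHit D h c) : b = c := by
  obtain ⟨m, h1, h2⟩ := hb
  obtain ⟨n, h3, h4⟩ := hc
  rcases lt_trichotomy m n with h | rfl | h
  · simp [h4 m h] at h1
  · simpa [h1] using h3
  · simp [h2 n h] at h3

theorem FirstHit.exists_of {β : Type*} {D : List ℕ → Option β} {h : ℕ → ℕ} {m : ℕ} {b : β}
    (hD : D (pre h m) = some b) : ∃ c, FirstHit D h c := by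
  classical
  have hex : ∃ m c, D (pre h m) = some c := ⟨m, b, hD⟩
  obtain ⟨c, hc⟩ := Nat.find_spec hex
  refine ⟨c, _, hc, fun j hj => ?_⟩
  have := Nat.find_min hex hj
  simpa [Option.eq_none_iff_forall_ne_some] using this

/-- Search for the first hit of `D` on the `e`-th row of the oracle, given a finite piece. -/
def hit {β : Type*} (v : ℕ → ℕ → ℕ) (D : List ℕ → Option β) (σ : List ℕ) (e : ℕ) : Option β :=
  firstSome (fun m => (rowPre v σ e m).bind D) (σ.length + 1)

/-- If `m` entries of the row are available, so are all shorter segments. Failures before `m` are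
thus failures of `D` itself and not due to a short piece of the oracle, so the answer does not
depend on the piece. -/
theorem firstHit_of_hit {β : Type*} {v : ℕ → ℕ → ℕ} {D : List ℕ → Option β} {g : ℕ → ℕ} {t e : ℕ}
    {b : β} (h : hit v D (pre g t) e = some b) : FirstHit D (row v g e) b := by
  obtain ⟨m, -, h1, h2⟩ := firstSome_eq_some.1 h
  obtain ⟨r, hr, hD⟩ := Option.bind_eq_some_iff.1 h1
  obtain ⟨hv, rfl⟩ := rowPre_eq_some.1 hr
  refine ⟨m, hD, fun j hj => ?_⟩
  have := h2 j hj
  rwa [rowPre_eq_some.2 ⟨fun i hi => hv i (hi.trans hj), rfl⟩] at this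

theorem FirstHit.eventually_hit {β : Type*} {v : ℕ → ℕ → ℕ} {D : List ℕ → Option β} {g : ℕ → ℕ}
    {e : ℕ} {b : β} (h : FirstHit D (row v g e) b) :
    ∀ᶠ t in atTop, hit v D (pre g t) e = some b := by
  obtain ⟨m, h1, h2⟩ := h
  filter_upwards [eventually_rowPre v g e m, eventually_ge_atTop m] with t ht hm
  refine firstSome_eq_some.2 ⟨m, by simp; omega, by simp [ht, h1], fun j hj => ?_⟩
  have hj' : rowPre v (pre g t) e j = some (pre (row v g e) j) :=
    rowPre_eq_some.2 ⟨fun i hi => (rowPre_eq_some.1 ht).1 i (hi.trans hj), rfl⟩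
  simp [hj', h2 j hj]

theorem computable_hit {β : Type*} [Primcodable β] {v : ℕ → ℕ → ℕ} {D : List ℕ → Option β}
    (hv : Computable₂ v) (hD : Computable D) : Computable₂ (hit v D) := by
  have hr : Computable fun q : (List ℕ × ℕ) × ℕ => rowPre v q.1.1 q.1.2 q.2 :=
    Computable.comp (g := fun q : (List ℕ × ℕ) × ℕ => (q.1.1, q.1.2, q.2)) (computable_rowPre hv)
      ((Computable.fst.comp Computable.fst).pair
        ((Computable.snd.comp Computable.fst).pair Computable.snd))
  have hb : Computable₂ fun (q : List ℕ × ℕ) (m : ℕ) => (rowPre v q.1 q.2 m).bind D :=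
    Computable.option_bind hr (hD.comp Computable.snd)
  have hn : Computable fun q : List ℕ × ℕ => q.1.length + 1 :=
    Computable.succ.comp (Computable.list_length.comp Computable.fst)
  exact computable_firstSome hb hn

/-! ### A team of a confident and an eventually-Popperian learner -/

/-- Given a finite row of values `k * x + y`, look for a place `i` with `y = φ_i(i)`, and return `x`;
the length of the row codes `i` and a bound on the computation. -/
def diagonalSearch (k : ℕ) (r : List ℕ) : Option ℕ :=
  r[r.length.unpair.1]?.bind fun z =>
    if evaln r.length.unpair.2 (Denumerable.ofNat Code r.length.unpair.1) r.length.unpair.1 =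
      some (z % k) then some (z / k) else none

theorem computable_diagonalSearch (k : ℕ) : Computable (diagonalSearch k) := by
  have hl : Primrec fun r : List ℕ => r.length := Primrec.list_length
  have h1 : Primrec fun r : List ℕ => r.length.unpair.1 :=
    Primrec.fst.comp (Primrec.unpair.comp hl)
  have h2 : Primrec fun r : List ℕ => r.length.unpair.2 :=
    Primrec.snd.comp (Primrec.unpair.comp hl)
  refine Primrec.to_comp (Primrec.option_bind (Primrec.list_getElem?.comp Primrec.id h1) ?_)
  refine Primrec.ite (Primrec.eq.comp (Code.primrec_evaln.comp
      (((h2.pair ((Primrec.ofNat Code).comp h1)).pair h1).comp Primrec.fst))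
      (Primrec.option_some.comp (Primrec.nat_mod.comp Primrec.snd (Primrec.const k))))
    (Primrec.option_some.comp (Primrec.nat_div.comp Primrec.snd (Primrec.const k)))
    (Primrec.const none)

theorem diagonalSearch_pre {k m x : ℕ} {h : ℕ → ℕ} (hx : diagonalSearch k (pre h m) = some x) :
    ∃ i, h i % k ∈ (Denumerable.ofNat Code i).eval i ∧ x = h i / k := by
  simp only [diagonalSearch, pre_length, Option.bind_eq_some_iff, pre_getElem?_eq_some] at hx
  obtain ⟨z, ⟨-, rfl⟩, hz⟩ := hx
  split_ifs at hz with hs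
  exact ⟨_, Code.evaln_sound hs, (Option.some.inj hz).symm⟩

theorem exists_diagonalSearch {k i s : ℕ} {h : ℕ → ℕ}
    (hs : evaln s (Denumerable.ofNat Code i) i = some (h i % k)) :
    ∃ m x, diagonalSearch k (pre h m) = some x := by
  -- A step bound of at least `i + 1` makes the coded length `Nat.pair i _` exceed `i`, so that
  -- entry `i` is present in the row.
  have hs' : evaln (max s (i + 1)) (Denumerable.ofNat Code i) i = some (h i % k) :=
    Code.evaln_mono (le_max_left _ _) hs
  refine ⟨Nat.pair i (max s (i + 1)), h i / k, ?_⟩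
  have hi : i < Nat.pair i (max s (i + 1)) :=
    (Nat.lt_of_succ_le (le_max_right _ _)).trans_le (Nat.right_le_pair _ _)
  simp [diagonalSearch, hi, hs']

theorem lt_of_mem_sq {k z : ℕ} (h : z < k ^ 2) : z / k < k ∧ z % k < k := by
  have hk : 0 < k := Nat.pos_of_ne_zero (by rintro rfl; simp at h)
  exact ⟨Nat.div_lt_of_lt_mul (by rwa [pow_two] at h), Nat.mod_lt _ hk⟩

/-- If the second component of the value `g (v e i) = k * x + y` is correct, the first is wrong. -/
theorem div_not_mem_eval {k : ℕ} {v : ℕ → ℕ → ℕ} {g : ℕ → ℕ} (hg : g ∈ DNRSet (k ^ 2))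
    (hv : ∀ a b x y, x ∈ (Denumerable.ofNat Code a).eval a → y ∈ (Denumerable.ofNat Code b).eval b →
      k * x + y ∈ (Denumerable.ofNat Code (v a b)).eval (v a b)) {e i : ℕ}
    (hi : row v g e i % k ∈ (Denumerable.ofNat Code i).eval i) :
    row v g e i / k ∉ (Denumerable.ofNat Code e).eval e := fun he => by
  have := hv e i _ _ he hi
  rw [Nat.div_add_mod] at this
  exact (hg _).2 this

/-- The number of initial `e` for which the search on the `e`-th row succeeds on `σ`. -/
def hitCount {β : Type*} (v : ℕ → ℕ → ℕ) (D : List ℕ → Option β) (σ : List ℕ) (n : ℕ) : ℕ :=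
  n.rec 0 fun e ih => bif (decide (ih = e) && (hit v D σ e).isSome) then e + 1 else ih

theorem hitCount_succ {β : Type*} (v : ℕ → ℕ → ℕ) (D : List ℕ → Option β) (σ : List ℕ) (n : ℕ) :
    hitCount v D σ (n + 1) = if hitCount v D σ n = n ∧ (hit v D σ n).isSome then n + 1
      else hitCount v D σ n := by
  rw [show hitCount v D σ (n + 1) = bif (decide (hitCount v D σ n = n) &&
    (hit v D σ n).isSome) then n + 1 else hitCount v D σ n from rfl, Bool.cond_eq_ite]
  simp

/-- The test `ih = e` in `hitCount` freezes the count at the first failing row, because from then on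
the count stays below the loop index. -/
theorem hitCount_eq {β : Type*} {v : ℕ → ℕ → ℕ} {D : List ℕ → Option β} {σ : List ℕ} {n e : ℕ}
    (hn : e < n) (h1 : ∀ j < e, (hit v D σ j).isSome) (h2 : hit v D σ e = none) :
    hitCount v D σ n = e := by
  have h : ∀ j ≤ e, hitCount v D σ j = j := by
    intro j
    induction j with
    | zero => simp [hitCount]
    | succ j ih => intro hj; simp [hitCount_succ, ih (by omega), h1 j hj]
  induction n, hn using Nat.le_induction with
  | base => simp [hitCount_succ, h e le_rfl, h2]
  | succ n hn ih =>
    rw [hitCount_succ, ih, if_neg]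
    omega

theorem computable_hitCount {β : Type*} [Primcodable β] {v : ℕ → ℕ → ℕ} {D : List ℕ → Option β}
    (hv : Computable₂ v) (hD : Computable D) :
    Computable fun σ : List ℕ => hitCount v D σ σ.length := by
  refine Computable.nat_rec (σ := ℕ) Computable.list_length (Computable.const 0)
    (h := fun σ p => bif (decide (p.2 = p.1) && (hit v D σ p.1).isSome) then p.1 + 1 else p.2) ?_
  have he : Computable fun p : List ℕ × ℕ × ℕ => p.2.1 := Computable.fst.comp Computable.snd
  have hi : Computable fun p : List ℕ × ℕ × ℕ => p.2.2 := Computable.snd.comp Computable.snd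
  refine Computable.cond ?_ (Computable.succ.comp he) hi
  exact Primrec.and.to_comp.comp (Primrec.eq.decide.to_comp.comp hi he)
    (Primrec.option_isSome.to_comp.comp ((computable_hit hv hD).comp Computable.fst he))

theorem exists_confident_popperian_team (k : ℕ) : ∃ Ψ : Fin 2 → List ℕ → ℕ,
    TeamReduces Ψ (DNRSet k) (DNRSet (k ^ 2)) ∧ IsConfident (Ψ 0) ∧
      IsEventuallyPopperian (Ψ 1) := by
  obtain ⟨v, hvc, hv⟩ := exists_diagonal_pair k
  have hD := computable_diagonalSearch k
  obtain ⟨idx, hidx, hidx'⟩ := exists_index_option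
    (F := fun _ σ e => hit v (diagonalSearch k) σ e)
    ((computable_hit hvc hD).comp (Computable.fst.comp Computable.snd)
      (Computable.snd.comp Computable.snd))
  obtain ⟨ind, hind, hind'⟩ := exists_index_option
    (F := fun e σ i => σ[v e i]?.map (· % k))
    (Computable.option_map (Computable.list_getElem?.comp (Computable.fst.comp Computable.snd)
        (hvc.comp Computable.fst (Computable.snd.comp Computable.snd)))
      (Primrec.nat_mod.to_comp.comp Computable.snd (Computable.const k)))
  -- Totality holds for every row and every oracle, inside `DNR_{k²}` or not; this makes the second
  -- learner eventually-Popperian.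
  have htot : ∀ e g n, (turingFunctional (ind e) g n).Dom := fun e g n =>
    (hind' e g n).2 (v e n + 1) (g (v e n) % k) (by simp)
  refine ⟨![fun _ => idx 0, fun σ => ind (hitCount v (diagonalSearch k) σ σ.length)],
    ⟨?_, fun g hg => ?_⟩, ?_, ?_⟩
  · intro i
    fin_cases i
    · exact Computable.const _
    · exact hind.comp (computable_hitCount hvc hD)
  · by_cases hall : ∀ e, ∃ x, FirstHit (diagonalSearch k) (row v g e) x
    · obtain ⟨f, hf, hfA⟩ := exists_computes (e := idx 0) (g := g)
        (A := fun e x => FirstHit (diagonalSearch k) (row v g e) x)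
        (fun e => by
          obtain ⟨x, hx⟩ := hall e
          obtain ⟨t, ht⟩ := hx.eventually_hit.exists
          exact (hidx' 0 g e).2 t x ht)
        (fun e x hx => by
          obtain ⟨t, ht⟩ := (hidx' 0 g e).1 x hx
          exact firstHit_of_hit ht)
      refine ⟨0, idx 0, Eventually.of_forall fun _ => rfl, f, hf, fun e => ?_⟩
      obtain ⟨m, hm, -⟩ := hfA e
      obtain ⟨i, hi, hx⟩ := diagonalSearch_pre hm
      rw [hx]
      exact ⟨(lt_of_mem_sq (hg _).1).1, div_not_mem_eval hg hv hi⟩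
    · push Not at hall
      classical
      let e := Nat.find hall
      have hno : ∀ x, ¬ FirstHit (diagonalSearch k) (row v g e) x := Nat.find_spec hall
      have hyes : ∀ j < e, ∃ x, FirstHit (diagonalSearch k) (row v g j) x := fun j hj => by
        have := Nat.find_min hall hj
        push Not at this
        exact this
      obtain ⟨f, hf, hfA⟩ := exists_computes (e := ind e) (g := g)
        (A := fun i x => row v g e i % k = x) (htot e g) (fun i x hx => by
          obtain ⟨t, ht⟩ := (hind' e g i).1 x hx
          obtain ⟨z, hz, rfl⟩ := Option.map_eq_some_iff.1 ht
          rw [← (pre_getElem?_eq_some.1 hz).2]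
          rfl)
      refine ⟨1, ind e, ?_, f, hf, mem_DNRSet.2 fun i => ?_⟩
      · have hev : ∀ᶠ t in atTop, ∀ j < e, (hit v (diagonalSearch k) (pre g t) j).isSome := by
          refine (Set.finite_lt_nat e).eventually_all.2 fun j hj => ?_
          obtain ⟨x, hx⟩ := hyes j hj
          exact hx.eventually_hit.mono fun t ht => by simp [ht]
        filter_upwards [hev, eventually_gt_atTop e] with t ht het
        have h2 : hit v (diagonalSearch k) (pre g t) e = none :=
          Option.eq_none_iff_forall_ne_some.2 fun x hx => hno x (firstHit_of_hit hx)
        simp [hitCount_eq het ht h2]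
      · rw [← hfA i]
        refine ⟨(lt_of_mem_sq (hg _).1).2, fun s hs => ?_⟩
        obtain ⟨m, x, hx⟩ := exists_diagonalSearch hs
        obtain ⟨y, hy⟩ := FirstHit.exists_of hx
        exact hno y hy
  · exact fun g => ⟨idx 0, Eventually.of_forall fun _ => rfl⟩
  · intro g e he n
    -- A limit of the second learner is one of its values, hence of the form `ind _`.
    obtain ⟨t, ht⟩ := he.exists
    rw [← ht]
    exact htot _ g n

/-! ### Composition of teams of learners -/

theorem mem_rfindOpt {β : Type*} {f : ℕ → Option β} {b : β} :
    b ∈ Nat.rfindOpt f ↔ ∃ m, f m = some b ∧ ∀ j < m, f j = none := by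
  rw [Nat.rfindOpt, Part.mem_bind_iff]
  refine exists_congr fun m => ?_
  refine (and_congr Nat.mem_rfind Part.mem_coe).trans ?_
  constructor
  · rintro ⟨⟨-, h⟩, hb⟩
    exact ⟨hb, fun j hj => by simpa using h hj⟩
  · rintro ⟨hb, h⟩
    exact ⟨⟨by simp [hb], fun hj => by simp [h _ hj]⟩, hb⟩

/-- The value of the `e`-th Turing functional found by a search bounded by the length of `σ`. -/
def boundedEval (e : ℕ) (σ : List ℕ) (n : ℕ) : Option ℕ :=
  firstSome (fun m => evaln m.unpair.2 (Denumerable.ofNat Code e)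
    (Nat.pair (Encodable.encode (σ.take m.unpair.1)) n)) σ.length

/-- Stage `m` of the dovetailing uses only `m.unpair.1 ≤ m` oracle values. The stages below `t`
therefore never look beyond `pre g t`, and the bounded search is an exact truncation of the
unbounded one. -/
theorem boundedEval_eq_some {e t n v : ℕ} {g : ℕ → ℕ} :
    boundedEval e (pre g t) n = some v ↔ ∃ m < t,
      evaln m.unpair.2 (Denumerable.ofNat Code e)
        (Nat.pair (Encodable.encode (pre g m.unpair.1)) n) = some v ∧
      ∀ j < m, evaln j.unpair.2 (Denumerable.ofNat Code e)
        (Nat.pair (Encodable.encode (pre g j.unpair.1)) n) = none := by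
  have htake : ∀ m < t, (pre g t).take m.unpair.1 = pre g m.unpair.1 := fun m hm =>
    pre_take g ((Nat.unpair_left_le m).trans hm.le)
  rw [boundedEval, firstSome_eq_some, pre_length]
  refine exists_congr fun m => and_congr_right fun hm => ?_
  rw [htake m hm]
  refine and_congr_right fun _ => forall₂_congr fun j hj => ?_
  rw [htake j (hj.trans hm)]

theorem mem_turingFunctional_of_boundedEval {e t n v : ℕ} {g : ℕ → ℕ}
    (h : boundedEval e (pre g t) n = some v) : v ∈ turingFunctional e g n := by
  obtain ⟨m, -, h⟩ := boundedEval_eq_some.1 h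
  exact mem_rfindOpt.2 ⟨m, h⟩

theorem eventually_boundedEval {e n v : ℕ} {g : ℕ → ℕ} (h : v ∈ turingFunctional e g n) :
    ∀ᶠ t in atTop, boundedEval e (pre g t) n = some v := by
  obtain ⟨m, h⟩ := mem_rfindOpt.1 h
  exact (eventually_gt_atTop m).mono fun t ht => boundedEval_eq_some.2 ⟨m, ht, h⟩

theorem computable_boundedEval :
    Computable fun p : ℕ × List ℕ × ℕ => boundedEval p.1 p.2.1 p.2.2 := by
  have he : Primrec₂ fun (p : ℕ × List ℕ × ℕ) (m : ℕ) => evaln m.unpair.2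
      (Denumerable.ofNat Code p.1) (Nat.pair (Encodable.encode (p.2.1.take m.unpair.1)) p.2.2) := by
    have hm : Primrec fun q : (ℕ × List ℕ × ℕ) × ℕ => q.2.unpair := Primrec.unpair.comp Primrec.snd
    have hp : Primrec fun q : (ℕ × List ℕ × ℕ) × ℕ => q.1.2 := Primrec.snd.comp Primrec.fst
    exact Code.primrec_evaln.comp (((Primrec.snd.comp hm).pair ((Primrec.ofNat Code).comp
      (Primrec.fst.comp Primrec.fst))).pair (Primrec₂.natPair.comp (Primrec.encode.comp
        (Primrec.list_take.comp (Primrec.fst.comp hm) (Primrec.fst.comp hp)))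
        (Primrec.snd.comp hp)))
  have hn : Computable fun p : ℕ × List ℕ × ℕ => p.2.1.length :=
    Computable.list_length.comp (Computable.fst.comp Computable.snd)
  exact computable_firstSome he.to_comp hn

/-- The initial segment of `Φ_e(g)` found in `n` rounds from the finite piece `σ` of `g`. -/
def evalPre (e : ℕ) (σ : List ℕ) (n : ℕ) : List ℕ :=
  n.rec [] fun _ τ => ((boundedEval e σ τ.length).map fun v => τ ++ [v]).getD τ

theorem evalPre_succ (e : ℕ) (σ : List ℕ) (n : ℕ) : evalPre e σ (n + 1) =
    ((boundedEval e σ (evalPre e σ n).length).map fun v => evalPre e σ n ++ [v]).getD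
      (evalPre e σ n) := rfl

theorem Computes.evalPre_eq {e : ℕ} {g f : ℕ → ℕ} (h : Computes e g f) (t n : ℕ) :
    evalPre e (pre g t) n = pre f (evalPre e (pre g t) n).length := by
  induction n with
  | zero => rfl
  | succ n ih =>
    rw [evalPre_succ]
    rcases hb : boundedEval e (pre g t) (evalPre e (pre g t) n).length with _ | v
    · simpa using ih
    · have hv : v = f _ := Part.mem_unique (mem_turingFunctional_of_boundedEval hb) (h _)
      simp only [Option.map_some, Option.getD_some, List.length_append, List.length_singleton,
        pre_succ, ← ih, ← hv]

theorem Computes.eventually_le_length_evalPre {e : ℕ} {g f : ℕ → ℕ} (h : Computes e g f) (l : ℕ) :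
    ∀ᶠ t in atTop, l ≤ (evalPre e (pre g t) t).length := by
  have hev : ∀ᶠ t in atTop, ∀ i < l, boundedEval e (pre g t) i = some (f i) :=
    (Set.finite_lt_nat l).eventually_all.2 fun i _ => eventually_boundedEval (h i)
  filter_upwards [hev, eventually_ge_atTop l] with t ht hl
  -- Once the first `l` values are available, each round adds an entry until length `l` is reached;
  -- later rounds never shorten the list.
  have key : ∀ n ≤ l, n ≤ (evalPre e (pre g t) n).length := by
    intro n
    induction n with
    | zero => simp
    | succ n ih =>
      intro hn
      rw [evalPre_succ]
      rcases hb : boundedEval e (pre g t) (evalPre e (pre g t) n).length with _ | v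
      · have : l ≤ (evalPre e (pre g t) n).length := by
          by_contra! hlt
          simp [ht _ hlt] at hb
        simpa using hn.trans this
      · simpa using ih (by omega)
  have hmono : Monotone fun n => (evalPre e (pre g t) n).length := by
    refine monotone_nat_of_le_succ fun n => ?_
    rw [evalPre_succ]
    rcases boundedEval e (pre g t) (evalPre e (pre g t) n).length with _ | v <;> simp
  exact (key l le_rfl).trans (hmono hl)

theorem computable_evalPre :
    Computable fun p : ℕ × List ℕ => evalPre p.1 p.2 p.2.length := by
  have hn : Computable fun p : ℕ × List ℕ => p.2.length := Computable.list_length.comp Computable.snd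
  have ht : Computable fun q : (ℕ × List ℕ) × ℕ × List ℕ => q.2.2 :=
    Computable.snd.comp Computable.snd
  have hb : Computable fun q : (ℕ × List ℕ) × ℕ × List ℕ => boundedEval q.1.1 q.1.2 q.2.2.length :=
    Computable.comp (g := fun q : (ℕ × List ℕ) × ℕ × List ℕ => (q.1.1, q.1.2, q.2.2.length))
      computable_boundedEval ((Computable.fst.comp Computable.fst).pair
        ((Computable.snd.comp Computable.fst).pair (Computable.list_length.comp ht)))
  have hc : Computable₂ fun (q : (ℕ × List ℕ) × ℕ × List ℕ) (v : ℕ) => q.2.2 ++ [v] :=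
    Computable.list_concat.comp (ht.comp Computable.fst) Computable.snd
  have hd : Computable₂ fun (p : ℕ × List ℕ) (q : ℕ × List ℕ) =>
      ((boundedEval p.1 p.2 q.2.length).map fun v => q.2 ++ [v]).getD q.2 :=
    Computable.option_getD (Computable.option_map hb hc) ht
  exact Computable.nat_rec (σ := List ℕ) hn (Computable.const []) hd

/-- Bounded evaluation of the composition of two Turing functionals, whose indices `a` codes. -/
def boundedComp (a : ℕ) (σ : List ℕ) (n : ℕ) : Option ℕ :=
  boundedEval a.unpair.2 (evalPre a.unpair.1 σ σ.length) n

theorem computable_boundedComp :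
    Computable fun p : ℕ × List ℕ × ℕ => boundedComp p.1 p.2.1 p.2.2 := by
  have ha : Computable fun p : ℕ × List ℕ × ℕ => p.1.unpair :=
    Computable.unpair.comp Computable.fst
  have ha1 : Computable fun p : ℕ × List ℕ × ℕ => p.1.unpair.1 := Computable.fst.comp ha
  have ha2 : Computable fun p : ℕ × List ℕ × ℕ => p.1.unpair.2 := Computable.snd.comp ha
  have hσ : Computable fun p : ℕ × List ℕ × ℕ => p.2.1 := Computable.fst.comp Computable.snd
  have hn : Computable fun p : ℕ × List ℕ × ℕ => p.2.2 := Computable.snd.comp Computable.snd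
  have h1 : Computable fun p : ℕ × List ℕ × ℕ => (p.1.unpair.1, p.2.1) := ha1.pair hσ
  have hp : Computable fun p : ℕ × List ℕ × ℕ => evalPre p.1.unpair.1 p.2.1 p.2.1.length :=
    (computable_evalPre.comp h1).of_eq fun _ => rfl
  have h2 : Computable fun p : ℕ × List ℕ × ℕ =>
      (p.1.unpair.2, evalPre p.1.unpair.1 p.2.1 p.2.1.length, p.2.2) := ha2.pair (hp.pair hn)
  exact (computable_boundedEval.comp h2).of_eq fun _ => rfl

/-- Indices of Turing functionals can be composed effectively. -/
theorem exists_comp_index : ∃ c : ℕ → ℕ → ℕ, Computable₂ c ∧ ∀ e e' g f h,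
    Computes e g f → Computes e' f h → Computes (c e e') g h := by
  obtain ⟨idx, hidx, hidx'⟩ := exists_index_option computable_boundedComp
  refine ⟨fun e e' => idx (Nat.pair e e'), hidx.comp (Primrec₂.natPair.to_comp.comp Computable.fst
    Computable.snd), fun e e' g f h hf hh => ?_⟩
  have hval : ∀ n t v, boundedEval e' (evalPre e (pre g t) t) n = some v → v = h n := by
    intro n t v hv
    rw [hf.evalPre_eq] at hv
    exact Part.mem_unique (mem_turingFunctional_of_boundedEval hv) (hh n)
  obtain ⟨h', hc, hA⟩ := exists_computes (e := idx (Nat.pair e e')) (g := g)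
    (A := fun n v => v = h n)
    (fun n => by
      obtain ⟨l, hl⟩ := eventually_atTop.1 (eventually_boundedEval (hh n))
      obtain ⟨t, ht⟩ := (hf.eventually_le_length_evalPre l).exists
      refine (hidx' (Nat.pair e e') g n).2 t (h n) ?_
      simp only [boundedComp, Nat.unpair_pair, pre_length]
      rw [hf.evalPre_eq]
      exact hl _ ht)
    (fun n v hv => by
      obtain ⟨t, ht⟩ := (hidx' (Nat.pair e e') g n).1 v hv
      simp only [boundedComp, Nat.unpair_pair, pre_length] at ht
      exact hval n t v ht)
  rwa [funext hA] at hc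

/-- The member `(i, j)` feeds `Θ j` with the part of the output of its current guess `Ψ i σ`
computed so far. After `Ψ i` has settled on a correct index, these parts are initial segments of the
intermediate function of unbounded length, so `Θ j` settles too. -/
theorem TeamReduces.trans {ι κ : Type*} {Ψ : ι → List ℕ → ℕ} {Θ : κ → List ℕ → ℕ}
    {P Q R : Set (ℕ → ℕ)} (h : TeamReduces Ψ Q R) (h' : TeamReduces Θ P Q) :
    ∃ Ξ : ι × κ → List ℕ → ℕ, TeamReduces Ξ P R := by
  obtain ⟨c, hc, hc'⟩ := exists_comp_index
  refine ⟨fun p σ => c (Ψ p.1 σ) (Θ p.2 (evalPre (Ψ p.1 σ) σ σ.length)), fun p => ?_,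
    fun g hg => ?_⟩
  · exact hc.comp (h.1 p.1) ((h'.1 p.2).comp (computable_evalPre.comp ((h.1 p.1).pair
      Computable.id)))
  · obtain ⟨i, e, hlim, f, hf, hfQ⟩ := h.2 g hg
    obtain ⟨j, e', hlim', f', hf', hfP⟩ := h'.2 f hfQ
    refine ⟨(i, j), c e e', ?_, f', hc' e e' g f f' hf hf', hfP⟩
    obtain ⟨l, hl⟩ := eventually_atTop.1 hlim'
    filter_upwards [hlim, hf.eventually_le_length_evalPre l] with t ht hlt
    simp only [ht, pre_length]
    rw [hf.evalPre_eq, hl _ hlt]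

theorem TeamReduces.red {ι : Type*} [Finite ι] {Ψ : ι → List ℕ → ℕ} {P Q : Set (ℕ → ℕ)}
    (h : TeamReduces Ψ P Q) : Red ComputableFinOmega P Q := by
  obtain ⟨b, ⟨φ⟩⟩ := Finite.exists_equiv_fin ι
  refine red_computableFinOmega_iff.2 ⟨b, fun i => Ψ (φ.symm i), fun i => h.1 _, fun g hg => ?_⟩
  obtain ⟨i, hi⟩ := h.2 g hg
  exact ⟨φ i, by simpa using hi⟩

theorem Red.finOmega_trans {P Q R : Set (ℕ → ℕ)} (h : Red ComputableFinOmega Q R)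
    (h' : Red ComputableFinOmega P Q) : Red ComputableFinOmega P R := by
  obtain ⟨_, _, h⟩ := red_computableFinOmega_iff.1 h
  obtain ⟨_, _, h'⟩ := red_computableFinOmega_iff.1 h'
  obtain ⟨_, h''⟩ := h.trans h'
  exact h''.red

theorem Red.finOmega_of_subset {P Q : Set (ℕ → ℕ)} (h : Q ⊆ P) : Red ComputableFinOmega P Q := by
  obtain ⟨idx, -, hidx⟩ := exists_index_option (F := fun _ σ n => σ[n]?)
    (Computable.list_getElem?.comp (Computable.fst.comp Computable.snd)
      (Computable.snd.comp Computable.snd))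
  have hT : TeamReduces (fun (_ : Unit) (_ : List ℕ) => idx 0) P Q := by
    refine ⟨fun _ => Computable.const _, fun g hg => ⟨(), _, Eventually.of_forall fun _ => rfl, ?_⟩⟩
    obtain ⟨f, hf, hA⟩ := exists_computes (e := idx 0) (g := g) (A := fun n v => g n = v)
      (fun n => (hidx 0 g n).2 (n + 1) (g n) (by simp)) (fun n v hv => by
        obtain ⟨t, ht⟩ := (hidx 0 g n).1 v hv
        exact (pre_getElem?_eq_some.1 ht).2)
    exact ⟨f, hf, h (funext hA ▸ hg)⟩
  exact hT.red

theorem red_finOmega_DNRSet_two (k : ℕ) : Red ComputableFinOmega (DNRSet 2) (DNRSet k) := by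
  have h : ∀ m, Red ComputableFinOmega (DNRSet 2) (DNRSet (2 ^ 2 ^ m)) := by
    intro m
    induction m with
    | zero => exact Red.finOmega_of_subset (by simp)
    | succ m ih =>
      obtain ⟨Ψ, hΨ, -⟩ := exists_confident_popperian_team (2 ^ 2 ^ m)
      refine Red.finOmega_trans ?_ ih
      rw [pow_succ 2 m, pow_mul]
      exact hΨ.red
  -- Squaring is iterated `k` times, as `k ≤ 2 ^ 2 ^ k`.
  refine Red.finOmega_trans (Red.finOmega_of_subset (DNRSet_mono ?_)) (h k)
  exact (Nat.lt_two_pow_self.trans (Nat.pow_lt_pow_right one_lt_two Nat.lt_two_pow_self)).le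

theorem Red.omega_one {P Q : Set (ℕ → ℕ)} (h : Red ComputableFinOmega P Q) :
    Red ComputableOmega1 P Q := by
  obtain ⟨Γ, ⟨b, Ψ, -, hΨ⟩, hΓ⟩ := h
  refine ⟨Γ, fun g f hf => ?_, hΓ⟩
  obtain ⟨-, e, -, f', hf', hc⟩ := hΨ g (Part.dom_iff_mem.2 ⟨f, hf⟩)
  exact Part.mem_unique hf' hf ▸ hc.turingReducible

theorem equivRed_finOmega_DNRSet {k : ℕ} (hk : 2 ≤ k) :
    EquivRed ComputableFinOmega (DNRSet k) (DNRSet 2) :=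
  ⟨Red.finOmega_of_subset (DNRSet_mono hk), red_finOmega_DNRSet_two k⟩

/-! ### Computable trees of diagonally noncomputable functions -/

theorem DNRSet_nonempty {k : ℕ} (hk : 2 ≤ k) : (DNRSet k).Nonempty := by
  classical
  refine ⟨fun e => if 0 ∈ (Denumerable.ofNat Code e).eval e then 1 else 0, fun e => ?_⟩
  dsimp only
  split_ifs with h
  · exact ⟨hk, fun h1 => absurd (Part.mem_unique h h1) (by decide)⟩
  · exact ⟨by omega, h⟩

theorem not_computable_of_mem_DNRSet {k : ℕ} {f : ℕ → ℕ} (hf : f ∈ DNRSet k) : ¬ Computable f := by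
  intro hc
  obtain ⟨c, hc⟩ := Code.exists_code.1 (Partrec.nat_iff.1 hc.partrec)
  apply (hf (Encodable.encode c)).2
  rw [Denumerable.ofNat_encode, hc]
  exact Part.mem_some _

/-- The tree of the strings that are not seen to violate diagonal noncomputability. -/
def dnrTree (k : ℕ) : Set (List ℕ) :=
  {σ | ∀ i < σ.length, σ.getD i 0 < k ∧
    evaln σ.length (Denumerable.ofNat Code i) i ≠ some (σ.getD i 0)}

theorem isComputableTreeOf_dnrTree (k : ℕ) : IsComputableTreeOf k (dnrTree k) (DNRSet k) where
  closed := by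
    rintro σ _ ⟨τ, rfl⟩ h i hi
    obtain ⟨h1, h2⟩ := h i (by simp; omega)
    rw [List.getD_append _ _ _ _ hi] at h1 h2
    exact ⟨h1, fun h => h2 (Code.evaln_mono (by simp) h)⟩
  bounded := by
    intro σ h x hx
    obtain ⟨i, hi, rfl⟩ := List.getElem_of_mem hx
    simpa [hi] using (h i hi).1
  computable := by
    have hl : Primrec fun p : ℕ × List ℕ => p.2.length := Primrec.list_length.comp Primrec.snd
    have hg : Primrec fun p : ℕ × List ℕ => p.2.getD p.1 0 :=
      (Primrec.list_getD 0).comp Primrec.snd Primrec.fst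
    have he : Primrec fun p : ℕ × List ℕ =>
        evaln p.2.length (Denumerable.ofNat Code p.1) p.1 :=
      Code.primrec_evaln.comp ((hl.pair ((Primrec.ofNat Code).comp Primrec.fst)).pair Primrec.fst)
    have hR : PrimrecRel fun (i : ℕ) (σ : List ℕ) => σ.getD i 0 < k ∧
        evaln σ.length (Denumerable.ofNat Code i) i ≠ some (σ.getD i 0) :=
      (Primrec.nat_lt.comp hg (Primrec.const k)).and
        (Primrec.eq.comp he (Primrec.option_some.comp hg)).not
    exact (PrimrecPred.of_eq (PrimrecRel.comp hR.forall_mem_list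
      (Primrec.list_range.comp Primrec.list_length) Primrec.id)
      fun σ => by simp [dnrTree]).computablePred
  body_eq := by
    ext f
    rw [mem_DNRSet]
    constructor
    · intro h e
      refine ⟨by simpa using (h (e + 1) e (by simp)).1, fun s hs => ?_⟩
      -- The string must be longer than `e`, and its length, which is also the step bound, must be
      -- at least `s`.
      apply (h (max s (e + 1)) e (by simp)).2
      simpa using Code.evaln_mono (le_max_left s (e + 1)) hs
    · intro h n i hi
      have hi' : i < n := by simpa using hi
      simpa [hi'] using ⟨(h i).1, (h i).2 n⟩

/-! ### Arbitrary computable trees with body `DNR_k` -/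

variable {k : ℕ} {S T : Set (List ℕ)}

theorem IsComputableTreeOf.mem_body (hS : IsComputableTreeOf k S (DNRSet k)) {f : ℕ → ℕ} :
    f ∈ DNRSet k ↔ ∀ n, pre f n ∈ S := by
  rw [← hS.body_eq]; rfl

/-- Finite sequences that avoid the diagonal values lie on the tree. -/
theorem IsComputableTreeOf.pre_mem (hS : IsComputableTreeOf k S (DNRSet k)) (hk : 2 ≤ k)
    {f : ℕ → ℕ} {n : ℕ} (hf : ∀ e < n, f e < k ∧ f e ∉ (Denumerable.ofNat Code e).eval e) :
    pre f n ∈ S := by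
  obtain ⟨d, hd⟩ := DNRSet_nonempty hk
  -- Diagonal noncomputability is a condition on each place separately, so the sequence can be
  -- continued by any element of `DNR_k`.
  have hg : (fun e => if e < n then f e else d e) ∈ DNRSet k := fun e => by
    dsimp only
    split_ifs with h
    exacts [hf e h, hd e]
  rw [pre_congr fun i hi => (if_pos hi).symm]
  exact hS.mem_body.1 hg n

theorem IsComputableTreeOf.nil_mem (hS : IsComputableTreeOf k S (DNRSet k)) (hk : 2 ≤ k) :
    [] ∈ S :=
  hS.pre_mem hk (f := 0) (n := 0) (by simp)

theorem IsComputableTreeOf.exists_decision (hS : IsComputableTreeOf k S (DNRSet k)) :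
    ∃ d : List ℕ → Bool, Computable d ∧ ∀ σ, d σ = true ↔ σ ∈ S := by
  obtain ⟨d, hd, h⟩ := ComputablePred.computable_iff.1 hS.computable
  exact ⟨d, hd, fun σ => (congrFun h σ).symm.to_iff⟩

theorem IsComputableTreeOf.mem_leaves_iff (hS : IsComputableTreeOf k S (DNRSet k)) {σ : List ℕ} :
    σ ∈ leaves S ↔ σ ∈ S ∧ ∀ j < k, σ ++ [j] ∉ S := by
  refine and_congr_right fun _ => ⟨fun h j _ hj => ?_, ?_⟩
  · exact h ⟨_, hj, List.prefix_append _ _, by simp⟩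
  · rintro h ⟨_, hτ, ⟨_ | ⟨j, τ⟩, rfl⟩, hne⟩
    · simp at hne
    · exact h j (hS.bounded _ hτ j (by simp)) (hS.closed _ _ ⟨τ, by simp⟩ hτ)

/-- The least immediate successor of a string on a tree, for a decision procedure `d`. -/
def leastChild (k : ℕ) (d : List ℕ → Bool) (σ : List ℕ) : Option ℕ :=
  firstSome (fun j => bif d (σ ++ [j]) then some j else none) k

theorem computable_leastChild {d : List ℕ → Bool} (hd : Computable d) :
    Computable (leastChild k d) := by
  have hd' : Computable₂ fun (σ : List ℕ) (j : ℕ) => bif d (σ ++ [j]) then some j else none :=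
    Computable.cond (hd.comp (Computable.list_concat.comp Computable.fst Computable.snd))
      (Computable.option_some.comp Computable.snd) (Computable.const none)
  exact computable_firstSome hd' (Computable.const k)

theorem leastChild_some {d : List ℕ → Bool} (hd : ∀ σ, d σ = true ↔ σ ∈ S) {σ : List ℕ} {j : ℕ}
    (h : leastChild k d σ = some j) : j < k ∧ σ ++ [j] ∈ S := by
  obtain ⟨i, hi, h, -⟩ := firstSome_eq_some.1 h
  rcases hb : d (σ ++ [i]) with _ | _
  · simp [hb] at h
  · simp only [hb, cond_true, Option.some.injEq] at h
    exact h ▸ ⟨hi, (hd _).1 hb⟩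

theorem leastChild_none {d : List ℕ → Bool} (hd : ∀ σ, d σ = true ↔ σ ∈ S) {σ : List ℕ}
    (h : leastChild k d σ = none) : ∀ j < k, σ ++ [j] ∉ S := by
  classical
  intro j hj hmem
  have hex : ∃ j, σ ++ [j] ∈ S := ⟨j, hmem⟩
  have hsome : leastChild k d σ = some (Nat.find hex) := by
    refine firstSome_eq_some.2 ⟨_, (Nat.find_min' hex hmem).trans_lt hj, ?_, fun i hi => ?_⟩
    · simp [(hd _).2 (Nat.find_spec hex)]
    · have := Nat.find_min hex hi
      rw [← hd] at this
      simp [this]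
  simp [h] at hsome

theorem IsComputableTreeOf.mem_leaves_iff_leastChild (hS : IsComputableTreeOf k S (DNRSet k))
    {d : List ℕ → Bool} (hd : ∀ σ, d σ = true ↔ σ ∈ S) {σ : List ℕ} :
    σ ∈ leaves S ↔ d σ = true ∧ leastChild k d σ = none := by
  rw [hS.mem_leaves_iff, hd]
  refine and_congr_right fun _ => ⟨fun h => ?_, leastChild_none hd⟩
  exact Option.eq_none_iff_forall_ne_some.2 fun j hj =>
    h j (leastChild_some hd hj).1 (leastChild_some hd hj).2

/-- Every string of the tree extends to a leaf, as the tree has no computable path. -/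
theorem IsComputableTreeOf.exists_leaf (hS : IsComputableTreeOf k S (DNRSet k)) {σ : List ℕ}
    (hσ : σ ∈ S) : ∃ ρ ∈ leaves S, σ <+: ρ := by
  by_contra! hno
  obtain ⟨d, hdc, hd⟩ := hS.exists_decision
  -- Always moving to the least child never gets stuck if no leaf extends `σ`, and traces a
  -- computable element of `DNR_k`. The default `0` is then never used.
  let P : ℕ → List ℕ := fun n => n.rec σ fun _ τ => τ ++ [(leastChild k d τ).getD 0]
  have hP : ∀ n, P n ∈ S ∧ σ <+: P n := by
    intro n
    induction n with
    | zero => exact ⟨hσ, List.prefix_rfl⟩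
    | succ n ih =>
      change P n ++ [(leastChild k d (P n)).getD 0] ∈ S ∧
        σ <+: P n ++ [(leastChild k d (P n)).getD 0]
      refine ⟨?_, ih.2.trans (List.prefix_append _ _)⟩
      rcases h : leastChild k d (P n) with _ | j
      · exact absurd ih.2 (hno _ ((hS.mem_leaves_iff_leastChild hd).2 ⟨(hd _).2 ih.1, h⟩))
      · exact (leastChild_some hd h).2
  have hmono : ∀ {m n}, m ≤ n → P m <+: P n := by
    intro m n h
    induction n, h using Nat.le_induction with
    | base => exact List.prefix_rfl
    | succ n _ ih => exact ih.trans (List.prefix_append _ _)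
  have hlen : ∀ n, n ≤ (P n).length := by
    intro n
    induction n with
    | zero => simp
    | succ n ih =>
      change n + 1 ≤ (P n ++ [_]).length
      simpa using ih
  have hPc : Computable P := by
    have hstep : Computable₂ fun (_ : ℕ) (p : ℕ × List ℕ) =>
        p.2 ++ [(leastChild k d p.2).getD 0] := by
      have h2 : Computable fun q : ℕ × ℕ × List ℕ => q.2.2 := Computable.snd.comp Computable.snd
      exact Computable.list_concat.comp h2 (Computable.option_getD
        ((computable_leastChild hdc).comp h2) (Computable.const 0))
    exact Computable.nat_rec (f := fun n : ℕ => n) Computable.id (Computable.const σ) hstep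
  have hfc : Computable fun n => (P (n + 1))[n]?.getD 0 :=
    Computable.option_getD (Computable.list_getElem?.comp (hPc.comp Computable.succ)
      Computable.id) (Computable.const 0)
  refine not_computable_of_mem_DNRSet (hS.mem_body.2 fun n => ?_) hfc
  refine hS.closed _ (P n) ?_ (hP n).1
  rw [List.prefix_iff_getElem?]
  intro i hi
  have hi' : i < n := by simpa using hi
  have h1 : i < (P (i + 1)).length := hlen (i + 1)
  have h2 := (List.prefix_iff_getElem?.1 (hmono (Nat.succ_le_of_lt hi'))) i h1
  rw [h2, pre_getElem]
  simp [h1]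

/-! ### Hyperconcatenation -/

/-- A truncation that ends inside some `ρ_i` leaves a prefix of a leaf, which lies on `S` and serves
as the new final string `σ`. -/
theorem hyperTree_closed (hT : ∀ σ τ : List ℕ, σ <+: τ → τ ∈ T → σ ∈ T)
    (hS : ∀ σ τ : List ℕ, σ <+: τ → τ ∈ S → σ ∈ S) {γ δ : List ℕ} (h : γ <+: δ)
    (hδ : δ ∈ hyperTree T S) : γ ∈ hyperTree T S := by
  obtain ⟨bs, σ, hbs, hl, hσ, rfl⟩ := hδ
  suffices H : ∃ bs' σ', bs' <+: bs ∧ σ' ∈ S ∧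
      γ = (bs'.map fun b => b.1 ++ [b.2]).flatten ++ σ' by
    obtain ⟨bs', σ', h1, h2, h3⟩ := H
    exact ⟨bs', σ', hT _ _ (h1.map _) hbs, fun b hb => hl b (h1.subset hb), h2, h3⟩
  clear hbs
  induction bs generalizing γ with
  | nil => exact ⟨[], γ, List.prefix_rfl, hS _ _ (by simpa using h) hσ, by simp⟩
  | cons b bs ih =>
    rw [List.map_cons, List.flatten_cons, List.append_assoc] at h
    rcases le_or_gt γ.length b.1.length with hle | hlt
    · have hγ : γ <+: b.1 := List.prefix_of_prefix_length_le h (by simp) hle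
      exact ⟨[], γ, List.nil_prefix, hS _ _ hγ (hl b (by simp)).1, by simp⟩
    · have hγ : b.1 ++ [b.2] <+: γ :=
        List.prefix_of_prefix_length_le (List.prefix_append _ _) h (by simpa using hlt)
      obtain ⟨γ', rfl⟩ := hγ
      rw [List.prefix_append_right_inj] at h
      obtain ⟨bs', σ', h1, h2, rfl⟩ := ih (fun c hc => hl c (List.mem_cons_of_mem _ hc)) h
      exact ⟨b :: bs', σ', List.cons_prefix_cons.2 ⟨rfl, h1⟩, h2, by simp⟩

/-- The infinite sequence `ρ` followed by `f`. -/
def prepend (ρ : List ℕ) (f : ℕ → ℕ) (n : ℕ) : ℕ :=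
  if h : n < ρ.length then ρ[n] else f (n - ρ.length)

theorem pre_prepend (ρ : List ℕ) (f : ℕ → ℕ) (n : ℕ) :
    pre (prepend ρ f) (ρ.length + n) = ρ ++ pre f n := by
  refine List.ext_getElem (by simp) fun i h1 h2 => ?_
  rw [pre_getElem, prepend]
  split_ifs with h
  · rw [List.getElem_append_left h]
  · rw [List.getElem_append_right (by omega), pre_getElem]

theorem prepend_mem_hyperconcat (hT : IsComputableTreeOf k T (DNRSet k))
    (hS : IsComputableTreeOf k S (DNRSet k)) {ρ : List ℕ} (hρ : ρ ∈ leaves S) {f h : ℕ → ℕ}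
    (hf : f ∈ DNRSet k) (hh : h ∈ DNRSet k) :
    prepend (ρ ++ [f 0]) h ∈ hyperconcat T S := by
  intro n
  refine hyperTree_closed hT.closed hS.closed (pre_prefix _ (Nat.le_add_left n (ρ ++ [f 0]).length)) ?_
  rw [pre_prepend]
  exact ⟨[(ρ, f 0)], pre h n, hT.mem_body.1 hf 1, by simpa using hρ, hS.mem_body.1 hh n, by simp⟩

theorem mem_hyperconcat_of_mem (hT : IsComputableTreeOf k T (DNRSet k)) (hk : 2 ≤ k)
    (hS : IsComputableTreeOf k S (DNRSet k)) {h : ℕ → ℕ} (hh : h ∈ DNRSet k) :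
    h ∈ hyperconcat T S := fun n =>
  ⟨[], pre h n, hT.nil_mem hk, by simp, hS.mem_body.1 hh n, by simp⟩

/-- No Turing functional maps the hyperconcatenation to diagonally noncomputable functions. -/
theorem not_red_hyperconcat (hk : 2 ≤ k) (hT : IsComputableTreeOf k T (DNRSet k))
    (hS : IsComputableTreeOf k S (DNRSet k)) (l : ℕ) :
    ¬ Red Computable11 (DNRSet l) (hyperconcat T S) := by
  intro hred
  obtain ⟨e, he⟩ := red_computable11_iff.1 hred
  obtain ⟨d, hdc, hd⟩ := hS.exists_decision
  obtain ⟨h, hh⟩ := DNRSet_nonempty hk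
  -- The program `c`, which knows its own index, searches for a string on `S` from which `Φ_e`
  -- computes a value at that index, and returns this value.
  let W : Code → ℕ → Option ℕ := fun c q =>
    bif d (Denumerable.ofNat (List ℕ) q) then
      boundedEval e (Denumerable.ofNat (List ℕ) q) (Encodable.encode c) else none
  have hW : Computable₂ W := by
    have hq : Computable fun p : Code × ℕ => Denumerable.ofNat (List ℕ) p.2 :=
      (Computable.ofNat (List ℕ)).comp Computable.snd
    exact Computable.cond (hdc.comp hq) (Computable.comp
      (g := fun p : Code × ℕ => (e, Denumerable.ofNat (List ℕ) p.2, Encodable.encode p.1))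
      computable_boundedEval ((Computable.const e).pair (hq.pair
        (Computable.encode.comp Computable.fst)))) (Computable.const none)
  obtain ⟨c, hc⟩ := Code.fixed_point₂ (f := fun c _ => Nat.rfindOpt (W c))
    ((Partrec.rfindOpt hW).comp Computable.fst)
  obtain ⟨v, hv⟩ : ∃ v, v ∈ Nat.rfindOpt (W c) := by
    obtain ⟨f, hf, -⟩ := he h (mem_hyperconcat_of_mem hT hk hS hh)
    obtain ⟨t, ht⟩ := (eventually_boundedEval (hf (Encodable.encode c))).exists
    refine Part.dom_iff_mem.1 (Nat.rfindOpt_dom.2 ⟨Encodable.encode (pre h t),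
      f (Encodable.encode c), ?_⟩)
    simp only [W, Denumerable.ofNat_encode, (hd _).2 (hS.mem_body.1 hh t), cond_true]
    exact ht
  obtain ⟨q, hq⟩ := Nat.rfindOpt_spec hv
  set σ := Denumerable.ofNat (List ℕ) q with hσ
  have hσS : d σ = true := by
    by_contra hne
    simp [W, ← hσ, Bool.eq_false_iff.2 hne] at hq
  have hσv : boundedEval e σ (Encodable.encode c) = some v := by
    simpa [W, ← hσ, hσS] using hq
  -- The string `σ` found need not extend to a path of `S`, but it extends to a leaf, and hence to a
  -- path of the hyperconcatenation. On that path `Φ_e` takes the forbidden value.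
  obtain ⟨ρ, hρ, hσρ⟩ := hS.exists_leaf ((hd σ).1 hσS)
  obtain ⟨f, hf, hfl⟩ := he _ (prepend_mem_hyperconcat hT hS hρ hh hh)
  have hpre : pre (prepend (ρ ++ [h 0]) h) σ.length = σ := by
    refine (eq_pre_of_prefix (n := (ρ ++ [h 0]).length + 0) ?_).symm
    rw [pre_prepend]
    exact (hσρ.trans (List.prefix_append _ _)).trans (List.prefix_append _ _)
  rw [← hpre] at hσv
  have hfv := Part.mem_unique (hf _) (mem_turingFunctional_of_boundedEval hσv)
  apply (hfl (Encodable.encode c)).2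
  rw [Denumerable.ofNat_encode, hc, hfv]
  exact hv

/-! ### Reducing the hyperconcatenation to diagonally noncomputable functions -/

/-- Given a finite row `r` whose remainders modulo `k` fail to be diagonally noncomputable, look for a
leaf `ρ` of the tree that extends the longest initial segment of the remainders on the tree, and
return it with the result of the diagonal search. Here `d` and `dl` decide the tree and its leaves,
and the length of the row codes the data that are looked for. -/
def blockSearch (k : ℕ) (d dl : List ℕ → Bool) (r : List ℕ) : Option (List ℕ × ℕ) :=
  let n := r.length.unpair.2.unpair.1
  let ρ := Denumerable.ofNat (List ℕ) r.length.unpair.2.unpair.2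
  bif (d ((r.take n).map (· % k)) && !d ((r.take (n + 1)).map (· % k))) &&
      (dl ρ && decide (ρ.take n = (r.take n).map (· % k))) then
    (diagonalSearch k (r.take r.length.unpair.1)).map fun x => (ρ, x)
  else none

theorem computable_blockSearch {d dl : List ℕ → Bool} (hd : Computable d) (hdl : Computable dl) :
    Computable (blockSearch k d dl) := by
  have hl : Primrec fun r : List ℕ => r.length.unpair := Primrec.unpair.comp Primrec.list_length
  have hl2 : Primrec fun r : List ℕ => r.length.unpair.2.unpair :=
    Primrec.unpair.comp (Primrec.snd.comp hl)
  have hn : Primrec fun r : List ℕ => r.length.unpair.2.unpair.1 := Primrec.fst.comp hl2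
  have hρ : Primrec fun r : List ℕ => Denumerable.ofNat (List ℕ) r.length.unpair.2.unpair.2 :=
    (Primrec.ofNat (List ℕ)).comp (Primrec.snd.comp hl2)
  have hmap : Primrec fun r : List ℕ => r.map (· % k) :=
    Primrec.list_map Primrec.id (Primrec.nat_mod.comp Primrec.snd (Primrec.const k))
  have hr1 : Primrec fun r : List ℕ => (r.take r.length.unpair.2.unpair.1).map (· % k) :=
    hmap.comp (Primrec.list_take.comp hn Primrec.id)
  have hr2 : Primrec fun r : List ℕ => (r.take (r.length.unpair.2.unpair.1 + 1)).map (· % k) :=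
    hmap.comp (Primrec.list_take.comp (Primrec.succ.comp hn) Primrec.id)
  have hc1 : Computable fun r : List ℕ => d ((r.take r.length.unpair.2.unpair.1).map (· % k)) &&
      !d ((r.take (r.length.unpair.2.unpair.1 + 1)).map (· % k)) :=
    Primrec.and.to_comp.comp (hd.comp hr1.to_comp) (Primrec.not.to_comp.comp (hd.comp hr2.to_comp))
  have hc2 : Computable fun r : List ℕ =>
      dl (Denumerable.ofNat (List ℕ) r.length.unpair.2.unpair.2) &&
        decide ((Denumerable.ofNat (List ℕ) r.length.unpair.2.unpair.2).take
          r.length.unpair.2.unpair.1 = (r.take r.length.unpair.2.unpair.1).map (· % k)) :=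
    Primrec.and.to_comp.comp (hdl.comp hρ.to_comp)
      (Primrec.eq.decide.comp (Primrec.list_take.comp hn hρ) hr1).to_comp
  have hs : Computable fun r : List ℕ => diagonalSearch k (r.take r.length.unpair.1) :=
    (computable_diagonalSearch k).comp
      (Primrec.list_take.comp (Primrec.fst.comp hl) Primrec.id).to_comp
  have hm : Computable₂ fun (r : List ℕ) (x : ℕ) =>
      (Denumerable.ofNat (List ℕ) r.length.unpair.2.unpair.2, x) :=
    (hρ.to_comp.comp Computable.fst).pair Computable.snd
  exact Computable.cond (Primrec.and.to_comp.comp hc1 hc2) (Computable.option_map hs hm)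
    (Computable.const none)

/-- The remainders modulo `k` of a row. -/
def rowMod (k : ℕ) (h : ℕ → ℕ) : ℕ → ℕ := fun i => h i % k

theorem blockSearch_eq_some {d dl : List ℕ → Bool} (hd : ∀ σ, d σ = true ↔ σ ∈ S)
    (hdl : ∀ σ, dl σ = true ↔ σ ∈ leaves S) {h : ℕ → ℕ} {m : ℕ} {b : List ℕ × ℕ}
    (hb : blockSearch k d dl (pre h m) = some b) :
    b.1 ∈ leaves S ∧
      (∃ n, pre (rowMod k h) (n + 1) ∉ S ∧ pre (rowMod k h) n <+: b.1) ∧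
      ∃ i, h i % k ∈ (Denumerable.ofNat Code i).eval i ∧ b.2 = h i / k := by
  simp only [blockSearch, pre_length, Bool.cond_eq_ite] at hb
  split_ifs at hb with hc
  simp only [Bool.and_eq_true, Bool.not_eq_true', decide_eq_true_eq, hd, hdl,
    ← Bool.not_eq_true] at hc
  obtain ⟨⟨h1, h2⟩, h3, h4⟩ := hc
  obtain ⟨x, hx, rfl⟩ := Option.map_eq_some_iff.1 hb
  -- Otherwise both truncations equal the whole row, which would be both on and off the tree.
  have hn : m.unpair.2.unpair.1 < m := by
    by_contra! hle
    rw [List.take_of_length_le (by simpa using hle)] at h1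
    rw [List.take_of_length_le (by simp; omega)] at h2
    exact h2 h1
  rw [pre_take _ hn.le, pre_map] at h4
  rw [pre_take _ hn, pre_map] at h2
  rw [pre_take _ (Nat.unpair_left_le m)] at hx
  exact ⟨h3, ⟨_, h2, h4 ▸ List.take_prefix _ _⟩, diagonalSearch_pre hx⟩

theorem lt_pair_of_pos {a b : ℕ} (ha : 0 < a) : b < Nat.pair a b :=
  (Nat.right_le_pair 0 b).trans_lt (Nat.pair_lt_pair_left b ha)

/-- Remainders outside `DNR_k` hit a diagonal value somewhere and also leave `S`, whose body is
`DNR_k`. The last node on `S` extends to a leaf, and all these data are coded in one length `m`. -/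
theorem exists_blockSearch (hS : IsComputableTreeOf k S (DNRSet k)) (hk : 2 ≤ k)
    {d dl : List ℕ → Bool} (hd : ∀ σ, d σ = true ↔ σ ∈ S)
    (hdl : ∀ σ, dl σ = true ↔ σ ∈ leaves S) {h : ℕ → ℕ} (hh : rowMod k h ∉ DNRSet k) :
    ∃ m b, blockSearch k d dl (pre h m) = some b := by
  classical
  obtain ⟨i, s, hs⟩ := exists_evaln_of_not_mem (fun e => Nat.mod_lt _ (by omega)) hh
  obtain ⟨a, x, hx⟩ := exists_diagonalSearch hs
  -- The diagonal search fails on the empty row. Positivity of `a` gives `n < m` below, so that the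
  -- first `n + 1` entries are present.
  have ha : 0 < a := by
    rcases Nat.eq_zero_or_pos a with rfl | ha
    · simp [diagonalSearch] at hx
    · exact ha
  have hex : ∃ n, pre (rowMod k h) n ∉ S := by
    by_contra! hc
    exact hh (hS.mem_body.2 hc)
  obtain ⟨n, hn⟩ : ∃ n, Nat.find hex = n + 1 := by
    refine Nat.exists_eq_succ_of_ne_zero fun h0 => ?_
    have := Nat.find_spec hex
    rw [h0] at this
    exact this (hS.nil_mem hk)
  have h1 : pre (rowMod k h) n ∈ S := not_not.1 (Nat.find_min hex (hn ▸ n.lt_succ_self))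
  have h2 : pre (rowMod k h) (n + 1) ∉ S := hn ▸ Nat.find_spec hex
  obtain ⟨ρ, hρ, hpre⟩ := hS.exists_leaf h1
  let m := Nat.pair a (Nat.pair n (Encodable.encode ρ))
  have hnm : n < m := (Nat.left_le_pair _ _).trans_lt (lt_pair_of_pos ha)
  have ham : a ≤ m := Nat.left_le_pair _ _
  refine ⟨m, (ρ, x), ?_⟩
  have htake : ρ.take n = pre (rowMod k h) n := by
    simpa using (List.prefix_iff_eq_take.1 hpre).symm
  simp only [blockSearch, pre_length, Bool.cond_eq_ite]
  rw [show m.unpair = (a, Nat.pair n (Encodable.encode ρ)) from Nat.unpair_pair _ _]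
  simp only [Nat.unpair_pair, Denumerable.ofNat_encode]
  rw [pre_take _ hnm.le, pre_take _ hnm, pre_take _ ham, pre_map, pre_map, hx, if_pos]
  · rfl
  · simp only [Bool.and_eq_true, Bool.not_eq_true', decide_eq_true_eq, hd, hdl, ← Bool.not_eq_true]
    exact ⟨⟨h1, h2⟩, hρ, htake⟩

/-- The concatenation of the first `e` blocks. -/
def blocks (B : ℕ → List ℕ × ℕ) (e : ℕ) : List ℕ :=
  (((List.range e).map B).map fun b => b.1 ++ [b.2]).flatten

theorem blocks_succ (B : ℕ → List ℕ × ℕ) (e : ℕ) :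
    blocks B (e + 1) = blocks B e ++ ((B e).1 ++ [(B e).2]) := by
  simp [blocks, List.range_succ]

theorem blocks_prefix (B : ℕ → List ℕ × ℕ) {e e' : ℕ} (h : e ≤ e') :
    blocks B e <+: blocks B e' := by
  induction e', h using Nat.le_induction with
  | base => exact List.prefix_rfl
  | succ n _ ih => exact ih.trans (blocks_succ B n ▸ List.prefix_append _ _)

theorem le_length_blocks (B : ℕ → List ℕ × ℕ) (e : ℕ) : e ≤ (blocks B e).length := by
  induction e with
  | zero => simp
  | succ e ih => simp only [blocks_succ, List.length_append, List.length_singleton]; omega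

/-- The concatenation of the first `e` blocks, as far as they are found from the finite piece `σ`. -/
def blocksPre (v : ℕ → ℕ → ℕ) (D : List ℕ → Option (List ℕ × ℕ)) (σ : List ℕ) (e : ℕ) :
    Option (List ℕ) :=
  e.rec (some []) fun i ih => ih.bind fun w => (hit v D σ i).map fun b => w ++ (b.1 ++ [b.2])

theorem blocksPre_succ (v : ℕ → ℕ → ℕ) (D : List ℕ → Option (List ℕ × ℕ)) (σ : List ℕ) (e : ℕ) :
    blocksPre v D σ (e + 1) = (blocksPre v D σ e).bind fun w =>
      (hit v D σ e).map fun b => w ++ (b.1 ++ [b.2]) := rfl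

theorem computable_blocksPre {v : ℕ → ℕ → ℕ} {D : List ℕ → Option (List ℕ × ℕ)}
    (hv : Computable₂ v) (hD : Computable D) : Computable₂ (blocksPre v D) := by
  have hh : Computable fun q : ((List ℕ × ℕ) × ℕ × Option (List ℕ)) × List ℕ =>
      hit v D q.1.1.1 q.1.2.1 :=
    (computable_hit hv hD).comp (Computable.fst.comp (Computable.fst.comp Computable.fst))
      (Computable.fst.comp (Computable.snd.comp Computable.fst))
  have ha : Computable₂ fun (q : ((List ℕ × ℕ) × ℕ × Option (List ℕ)) × List ℕ)
      (b : List ℕ × ℕ) => q.2 ++ (b.1 ++ [b.2]) :=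
    Computable.list_append.comp (Computable.snd.comp Computable.fst)
      (Computable.list_concat.comp (Computable.fst.comp Computable.snd)
        (Computable.snd.comp Computable.snd))
  have h0 : Computable fun q : (List ℕ × ℕ) × ℕ × Option (List ℕ) => q.2.2 :=
    Computable.snd.comp Computable.snd
  have hs : Computable₂ fun (p : List ℕ × ℕ) (q : ℕ × Option (List ℕ)) =>
      q.2.bind fun w => (hit v D p.1 q.1).map fun b => w ++ (b.1 ++ [b.2]) :=
    Computable.option_bind h0 (Computable.option_map hh ha)
  exact Computable.nat_rec (f := fun p : List ℕ × ℕ => p.2) Computable.snd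
    (Computable.const (some [])) hs

theorem blocksPre_eq_some {v : ℕ → ℕ → ℕ} {D : List ℕ → Option (List ℕ × ℕ)} {g : ℕ → ℕ}
    {B : ℕ → List ℕ × ℕ}
    (hB : ∀ i b, FirstHit D (row v g i) b → FirstHit D (row v g i) (B i)) {t e : ℕ} {w : List ℕ}
    (h : blocksPre v D (pre g t) e = some w) :
    (∀ i < e, FirstHit D (row v g i) (B i)) ∧ w = blocks B e := by
  induction e generalizing w with
  | zero => simpa [blocksPre, blocks, eq_comm] using h
  | succ e ih =>
    rw [blocksPre_succ, Option.bind_eq_some_iff] at h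
    obtain ⟨w', hw', h⟩ := h
    obtain ⟨b, hb, rfl⟩ := Option.map_eq_some_iff.1 h
    obtain ⟨h1, rfl⟩ := ih hw'
    have hb := firstHit_of_hit hb
    rw [Nat.forall_lt_succ_right, blocks_succ, hb.unique (hB e b hb)]
    exact ⟨⟨h1, hB e b hb⟩, rfl⟩

theorem eventually_blocksPre {v : ℕ → ℕ → ℕ} {D : List ℕ → Option (List ℕ × ℕ)} {g : ℕ → ℕ}
    {B : ℕ → List ℕ × ℕ} {e : ℕ} (h : ∀ i < e, FirstHit D (row v g i) (B i)) :
    ∀ᶠ t in atTop, blocksPre v D (pre g t) e = some (blocks B e) := by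
  induction e with
  | zero => exact Eventually.of_forall fun _ => rfl
  | succ e ih =>
    filter_upwards [ih fun i hi => h i (by omega), (h e (by omega)).eventually_hit] with t h1 h2
    simp [blocksPre_succ, h1, h2, blocks_succ]

/-- The first `e` blocks, followed by `j` remainders of the next row if these are on the tree, as far
as all this is found from the finite piece `σ` of the oracle. -/
def word (k : ℕ) (v : ℕ → ℕ → ℕ) (D : List ℕ → Option (List ℕ × ℕ)) (d : List ℕ → Bool)
    (σ : List ℕ) (e j : ℕ) : Option (List ℕ) :=
  (blocksPre v D σ e).bind fun w => (rowPre v σ e j).bind fun r =>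
    bif d (r.map (· % k)) then some (w ++ r.map (· % k)) else none

theorem computable_word {v : ℕ → ℕ → ℕ} {D : List ℕ → Option (List ℕ × ℕ)} {d : List ℕ → Bool}
    (hv : Computable₂ v) (hD : Computable D) (hd : Computable d) :
    Computable fun p : List ℕ × ℕ × ℕ => word k v D d p.1 p.2.1 p.2.2 := by
  have hb : Computable fun p : List ℕ × ℕ × ℕ => blocksPre v D p.1 p.2.1 :=
    (computable_blocksPre hv hD).comp Computable.fst (Computable.fst.comp Computable.snd)
  have hr : Computable fun q : (List ℕ × ℕ × ℕ) × List ℕ => rowPre v q.1.1 q.1.2.1 q.1.2.2 :=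
    Computable.comp (g := fun q : (List ℕ × ℕ × ℕ) × List ℕ => q.1) (computable_rowPre hv)
      Computable.fst
  have hmap : Primrec fun r : List ℕ => r.map (· % k) :=
    Primrec.list_map Primrec.id (Primrec.nat_mod.comp Primrec.snd (Primrec.const k))
  have hm : Computable fun q : ((List ℕ × ℕ × ℕ) × List ℕ) × List ℕ => q.2.map (· % k) :=
    hmap.to_comp.comp Computable.snd
  have hc : Computable₂ fun (q : (List ℕ × ℕ × ℕ) × List ℕ) (r : List ℕ) =>
      bif d (r.map (· % k)) then some (q.2 ++ r.map (· % k)) else none :=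
    Computable.cond (hd.comp hm) (Computable.option_some.comp (Computable.list_append.comp
      (Computable.snd.comp Computable.fst) hm)) (Computable.const none)
  exact Computable.option_bind hb (Computable.option_bind hr hc)

/-- The `n`-th entry of one of the words `u σ e j`; the first argument is a dummy index. -/
def wordEntry (u : List ℕ → ℕ → ℕ → Option (List ℕ)) (_ : ℕ) (σ : List ℕ) (n : ℕ) : Part ℕ :=
  Nat.rfindOpt fun c => (u σ c.unpair.1 c.unpair.2).bind fun w => w[n]?

theorem partrec_wordEntry {u : List ℕ → ℕ → ℕ → Option (List ℕ)}
    (hu : Computable fun p : List ℕ × ℕ × ℕ => u p.1 p.2.1 p.2.2) :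
    Partrec fun p : ℕ × List ℕ × ℕ => wordEntry u p.1 p.2.1 p.2.2 := by
  have hc : Computable fun q : (ℕ × List ℕ × ℕ) × ℕ => q.2.unpair :=
    Computable.unpair.comp Computable.snd
  have hc1 : Computable fun q : (ℕ × List ℕ × ℕ) × ℕ => q.2.unpair.1 := Computable.fst.comp hc
  have hc2 : Computable fun q : (ℕ × List ℕ × ℕ) × ℕ => q.2.unpair.2 := Computable.snd.comp hc
  have hσ : Computable fun q : (ℕ × List ℕ × ℕ) × ℕ => q.1.2.1 :=
    Computable.fst.comp (Computable.snd.comp Computable.fst)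
  have hp : Computable fun q : (ℕ × List ℕ × ℕ) × ℕ => (q.1.2.1, q.2.unpair.1, q.2.unpair.2) :=
    hσ.pair (hc1.pair hc2)
  have hw : Computable fun q : (ℕ × List ℕ × ℕ) × ℕ => u q.1.2.1 q.2.unpair.1 q.2.unpair.2 :=
    (hu.comp hp).of_eq fun _ => rfl
  have hi : Computable₂ fun (q : (ℕ × List ℕ × ℕ) × ℕ) (w : List ℕ) => w[q.1.2.2]? :=
    Computable.list_getElem?.comp Computable.snd
      (Computable.snd.comp (Computable.snd.comp (Computable.fst.comp Computable.fst)))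
  have hb : Computable₂ fun (p : ℕ × List ℕ × ℕ) (c : ℕ) =>
      (u p.2.1 c.unpair.1 c.unpair.2).bind fun w => w[p.2.2]? :=
    Computable.option_bind hw hi
  exact Partrec.rfindOpt hb

/-- The values of `f` may be read off different words, but comparable words agree wherever both are
defined, so one long word gives them all. -/
theorem pre_prefix_of_chain {W : Set (List ℕ)} {f : ℕ → ℕ}
    (hchain : ∀ w ∈ W, ∀ w' ∈ W, w <+: w' ∨ w' <+: w) (hlen : ∀ n, ∃ w ∈ W, n ≤ w.length)
    (hf : ∀ n, ∃ w ∈ W, w[n]? = some (f n)) (n : ℕ) : ∃ w ∈ W, pre f n <+: w := by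
  obtain ⟨w, hw, hn⟩ := hlen n
  refine ⟨w, hw, List.prefix_iff_getElem?.2 fun i hi => ?_⟩
  have hi' : i < w.length := lt_of_lt_of_le (by simpa using hi) hn
  obtain ⟨w', hw', hwi⟩ := hf i
  obtain ⟨hi'', -⟩ := List.getElem?_eq_some_iff.1 hwi
  rw [pre_getElem, ← hwi]
  rcases hchain w hw w' hw' with h | h
  · rw [List.prefix_iff_getElem?.1 h i hi', List.getElem?_eq_getElem hi']
  · rw [List.prefix_iff_getElem?.1 h i hi'', List.getElem?_eq_getElem hi'']

theorem red_hyperconcat (hk : 2 ≤ k) (hT : IsComputableTreeOf k T (DNRSet k))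
    (hS : IsComputableTreeOf k S (DNRSet k)) :
    Red Computable11 (hyperconcat T S) (DNRSet (k ^ 2)) := by
  obtain ⟨v, hvc, hv⟩ := exists_diagonal_pair k
  obtain ⟨d, hdc, hd⟩ := hS.exists_decision
  obtain ⟨dl, hdlc, hdl⟩ : ∃ dl : List ℕ → Bool, Computable dl ∧
      ∀ σ, dl σ = true ↔ σ ∈ leaves S := by
    refine ⟨fun σ => d σ && !(leastChild k d σ).isSome, Primrec.and.to_comp.comp hdc
      (Primrec.not.to_comp.comp (Primrec.option_isSome.to_comp.comp (computable_leastChild hdc))),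
      fun σ => ?_⟩
    rw [hS.mem_leaves_iff_leastChild hd]
    simp
  set D := blockSearch k d dl
  have hDc : Computable D := computable_blockSearch hdc hdlc
  obtain ⟨idx, -, hidx⟩ := exists_index
    (partrec_wordEntry (computable_word (k := k) hvc hDc hdc))
  refine red_computable11_iff.2 ⟨idx 0, fun g hg => ?_⟩
  -- Rows without a hit get a junk block; the set `W` uses block `i` only where a hit is known.
  have hBex : ∀ i, ∃ B, ∀ b, FirstHit D (row v g i) b → FirstHit D (row v g i) B := fun i => by
    by_cases h : ∃ b, FirstHit D (row v g i) b
    · exact ⟨h.choose, fun _ _ => h.choose_spec⟩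
    · exact ⟨([], 0), fun b hb => absurd ⟨b, hb⟩ h⟩
  choose B hB using hBex
  let h : ℕ → ℕ → ℕ := fun e => rowMod k (row v g e)
  let W : Set (List ℕ) := {w | ∃ e j, (∀ i < e, FirstHit D (row v g i) (B i)) ∧
    pre (h e) j ∈ S ∧ w = blocks B e ++ pre (h e) j}
  have hWord : ∀ t e j w, word k v D d (pre g t) e j = some w → w ∈ W := by
    intro t e j w hw
    obtain ⟨u, hu, hw⟩ := Option.bind_eq_some_iff.1 hw
    obtain ⟨r, hr, hw⟩ := Option.bind_eq_some_iff.1 hw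
    obtain ⟨h1, rfl⟩ := blocksPre_eq_some hB hu
    obtain ⟨-, rfl⟩ := rowPre_eq_some.1 hr
    rw [pre_map, Bool.cond_eq_ite] at hw
    split_ifs at hw with hdr
    exact ⟨e, j, h1, (hd _).1 hdr, (Option.some.inj hw).symm⟩
  have hWord' : ∀ w ∈ W, ∃ t e j, word k v D d (pre g t) e j = some w := by
    rintro _ ⟨e, j, h1, h2, rfl⟩
    obtain ⟨t, ht1, ht2⟩ := ((eventually_blocksPre h1).and (eventually_rowPre v g e j)).exists
    refine ⟨t, e, j, ?_⟩
    have h3 : d ((pre (row v g e) j).map (· % k)) = true := by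
      rw [pre_map, hd]
      exact h2
    simp only [word, ht1, ht2, Option.bind_some, h3, cond_true]
    rw [pre_map]
    rfl
  have hchain' : ∀ e e' j j', e ≤ e' → (∀ i < e', FirstHit D (row v g i) (B i)) →
      pre (h e) j ∈ S → blocks B e ++ pre (h e) j <+: blocks B e' ++ pre (h e') j' ∨
        blocks B e' ++ pre (h e') j' <+: blocks B e ++ pre (h e) j := by
    intro e e' j j' hle hB' hj
    rcases hle.eq_or_lt with rfl | hlt
    · simp only [List.prefix_append_right_inj]
      exact (le_total j j').imp (pre_prefix _) (pre_prefix _)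
    · left
      obtain ⟨m, hm, -⟩ := hB' e hlt
      -- The leaf chosen for row `e` extends the remainders up to a length `n` after which they are
      -- off `S`. Any remainders copied earlier were on `S`, so the leaf extends them and no output
      -- is revoked.
      obtain ⟨-, ⟨n, hn, hpre⟩, -⟩ := blockSearch_eq_some hd hdl hm
      have hjn : j ≤ n := by
        by_contra! hnj
        exact hn (hS.closed _ _ (pre_prefix _ hnj) hj)
      refine List.IsPrefix.trans ?_ ((blocks_prefix B (Nat.succ_le_of_lt hlt)).trans
        (List.prefix_append _ _))
      rw [Nat.succ_eq_add_one, blocks_succ, List.prefix_append_right_inj]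
      exact ((pre_prefix _ hjn).trans hpre).trans (List.prefix_append _ _)
  have hchain : ∀ w ∈ W, ∀ w' ∈ W, w <+: w' ∨ w' <+: w := by
    rintro _ ⟨e, j, h1, h2, rfl⟩ _ ⟨e', j', h1', h2', rfl⟩
    rcases le_total e e' with hle | hle
    · exact hchain' e e' j j' hle h1' h2
    · exact (hchain' e' e j' j hle h1 h2').symm
  have hlen : ∀ n, ∃ w ∈ W, n ≤ w.length := by
    intro n
    -- Either every row yields a block, or the remainders of the first row without one lie in
    -- `DNR_k` and can be copied forever.
    by_cases hall : ∀ e, FirstHit D (row v g e) (B e)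
    · exact ⟨_, ⟨n, 0, fun i _ => hall i, hS.nil_mem hk, rfl⟩,
        (le_length_blocks B n).trans (by simp)⟩
    · classical
      push Not at hall
      have hno : h (Nat.find hall) ∈ DNRSet k := by
        by_contra hnd
        obtain ⟨m, b, hb⟩ := exists_blockSearch hS hk hd hdl hnd
        obtain ⟨b', hb'⟩ := FirstHit.exists_of hb
        exact Nat.find_spec hall (hB _ b' hb')
      exact ⟨_, ⟨Nat.find hall, n, fun i hi => not_not.1 (Nat.find_min hall hi),
        hS.mem_body.1 hno n, rfl⟩, by simp⟩
  have hWtree : ∀ w ∈ W, w ∈ hyperTree T S := by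
    rintro _ ⟨e, j, h1, h2, rfl⟩
    have h3 : ∀ i < e, (B i).1 ∈ leaves S ∧
        ∃ l, row v g i l % k ∈ (Denumerable.ofNat Code l).eval l ∧ (B i).2 = row v g i l / k := by
      intro i hi
      obtain ⟨m, hm, -⟩ := h1 i hi
      obtain ⟨h3, -, h4⟩ := blockSearch_eq_some hd hdl hm
      exact ⟨h3, h4⟩
    refine ⟨(List.range e).map B, pre (h e) j, ?_, ?_, h2, rfl⟩
    · rw [List.map_map]
      -- The finitely many quotients avoid the diagonal values, which puts them on any tree `T` with
      -- body `DNR_k`.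
      refine hT.pre_mem hk (f := Prod.snd ∘ B) fun i hi => ?_
      obtain ⟨-, l, hl, hBl⟩ := h3 i hi
      rw [Function.comp_apply, hBl]
      exact ⟨(lt_of_mem_sq (hg _).1).1, div_not_mem_eval hg hv hl⟩
    · simp only [List.mem_map, List.mem_range]
      rintro _ ⟨i, hi, rfl⟩
      exact (h3 i hi).1
  obtain ⟨f, hf, hfA⟩ := exists_computes (e := idx 0) (g := g)
    (A := fun n x => ∃ w ∈ W, w[n]? = some x)
    (fun n => by
      obtain ⟨w, hw, hn⟩ := hlen (n + 1)
      obtain ⟨t, e, j, ht⟩ := hWord' w hw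
      refine (hidx 0 g n).2 t (Nat.rfindOpt_dom.2 ⟨Nat.pair e j, w[n], ?_⟩)
      simp [ht])
    (fun n x hx => by
      obtain ⟨t, ht⟩ := (hidx 0 g n).1 x hx
      obtain ⟨c, hc⟩ := Nat.rfindOpt_spec ht
      obtain ⟨w, hw, hwn⟩ := Option.bind_eq_some_iff.1 hc
      exact ⟨w, hWord _ _ _ _ hw, hwn⟩)
  refine ⟨f, hf, fun n => ?_⟩
  obtain ⟨w, hw, hpre⟩ := pre_prefix_of_chain hchain hlen hfA n
  exact hyperTree_closed hT.closed hS.closed hpre (hWtree w hw)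

end DNR

theorem mainTheorem8 :
    -- `DNR_k ⊛ DNR_k <¹₁ DNR_{k²}`, for all computable trees representing `DNR_k`
    (∀ k : ℕ, 2 ≤ k →
      (∃ T, DNR.IsComputableTreeOf k T (DNR.DNRSet k)) ∧
      ∀ T S : Set (List ℕ), DNR.IsComputableTreeOf k T (DNR.DNRSet k) →
        DNR.IsComputableTreeOf k S (DNR.DNRSet k) →
        DNR.StrictRed DNR.Computable11 (DNR.hyperconcat T S) (DNR.DNRSet (k ^ 2))) ∧
    -- `DNR_k` and `DNR_2` are `(<ω, ω)`-equivalent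
    (∀ k : ℕ, 2 ≤ k →
      DNR.EquivRed DNR.ComputableFinOmega (DNR.DNRSet k) (DNR.DNRSet 2)) ∧
    -- the team consisting of a confident and an eventually-Popperian learner
    (∀ k : ℕ, ∃ (Γ : (ℕ → ℕ) →. (ℕ → ℕ)) (Ψ : Fin 2 → List ℕ → ℕ),
      DNR.MapsInto Γ (DNR.DNRSet (k ^ 2)) (DNR.DNRSet k) ∧
      DNR.IdentifiedByTeam Γ Ψ ∧
      DNR.IsConfident (Ψ 0) ∧ DNR.IsEventuallyPopperian (Ψ 1)) ∧
    -- in particular, `DNR_k` and `DNR_2` are Muchnik equivalent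
    (∀ k : ℕ, 2 ≤ k →
      DNR.EquivRed DNR.ComputableOmega1 (DNR.DNRSet k) (DNR.DNRSet 2)) := by
  refine ⟨fun k hk => ⟨⟨_, DNR.isComputableTreeOf_dnrTree k⟩, fun T S hT hS =>
    ⟨DNR.red_hyperconcat hk hT hS, DNR.not_red_hyperconcat hk hT hS _⟩⟩,
    fun k hk => DNR.equivRed_finOmega_DNRSet hk, fun k => ?_, fun k hk => ?_⟩
  · obtain ⟨Ψ, hΨ, h1, h2⟩ := DNR.exists_confident_popperian_team k
    obtain ⟨Γ, h3, h4⟩ := hΨ.exists_identified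
    exact ⟨Γ, Ψ, h3, h4, h1, h2⟩
  · obtain ⟨h1, h2⟩ := DNR.equivRed_finOmega_DNRSet hk
    exact ⟨h1.omega_one, h2.omega_one⟩
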